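/- Let $n\ge 1$ and $\beta\in(-\infty,0)\cup(0,\tfrac1n)$. Let $\mathcal P_n$ be the set of real symmetric positive-definite $n\times n$ matrices, an open subset of the space $\mathcal S_n$ of real symmetric $n\times n$ matrices, so that its tangent space at every point is $\mathcal S_n$. Endow $\mathcal P_n$ with the Riemannian metric $$g^\beta_X(A,B)=(\det X)^\beta\bigl(\operatorname{tr}(X^{-1}AX^{-1}B)-\beta\operatorname{tr}(X^{-1}A)\operatorname{tr}(X^{-1}B)\bigr),\qquad X\in\mathcal P_n,\ A,B\in\mathcal S_n,$$ and denote the resulting Riemannian manifold by $\mathcal M_n^\beta$. A submanifold $N$ of a Riemannian manifold $(M,g)$ is called totally geodesic if any geodesic of $N$ with its induced Riemannian metric is also a geodesic of $(M,g)$. Then the set of positive-definite diagonal $n\times n$ matrices and the set $\{\alpha I:\alpha>0\}$ of positive scalar $n\times n$ matrices are (smooth, embedded) totally geodesic submanifolds of $\mathcal M_n^\beta$. This holds for both usual meanings of "geodesic": 1. geodesics as smooth curves, defined on any open interval, that satisfy the geodesic equation $\nabla_{\gamma'}\gamma'=0$ of the Levi-Civita connection; 2. geodesics joining two points as $C^2$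 curves $\gamma:[0,1]\to M$ that minimize the length $\int_0^1\sqrt{g_{\gamma(t)}(\gamma'(t),\gamma'(t))}\,dt$ among all $C^2$ curves $[0,1]\to M$ with the same end points (for $N$: among such curves in $N$). -/

import Mathlib

open Bundle Manifold Set Topology
open scoped ContDiff

noncomputable section

/-! ### Geodesics and totally geodesic submanifolds -/

section Riemannian

/-- A field of pairings on the tangent spaces of `M` (a covariant 2-tensor field), the underlying
data of a Riemannian metric. -/
abbrev TangentPairing (E : Type*) [NormedAddCommGroup E] [NormedSpace ℝ E]
    (M : Type*) [TopologicalSpace M] [ChartedSpace E M] :=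
  ∀ x : M, TangentSpace 𝓘(ℝ, E) x → TangentSpace 𝓘(ℝ, E) x → ℝ

variable {E : Type*} [NormedAddCommGroup E] [NormedSpace ℝ E]
  {M : Type*} [TopologicalSpace M] [ChartedSpace E M]
  {F : Type*} [NormedAddCommGroup F] [NormedSpace ℝ F]
  {N : Type*} [TopologicalSpace N] [ChartedSpace F N]

/-- The pull-back `(f^* g)_x(v, w) = g_{f(x)}(df_x v, df_x w)`. For the inclusion of a submanifold
this is the induced metric. -/
def TangentPairing.pullback (g : TangentPairing E M) (f : N → M) : TangentPairing F N :=
  fun x v w => g (f x) (mfderiv 𝓘(ℝ, F) 𝓘(ℝ, E) f x v) (mfderiv 𝓘(ℝ, F) 𝓘(ℝ, E) f x w)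

/-- The expression of `g` in the chart around `x₀`: at the point `y` of the chart domain in `E`,
a pairing of vectors of `E`. -/
def TangentPairing.inChart (g : TangentPairing E M) (x₀ : M) (y v w : E) : ℝ :=
  g.pullback (F := E) (extChartAt 𝓘(ℝ, E) x₀).symm y v w

/-- The Christoffel symbols of the first kind of `g` in the chart around `x₀`, that is
`Γ(u, v; w) = (∂_u g(v, w) + ∂_v g(u, w) - ∂_w g(u, v)) / 2`. -/
def TangentPairing.christoffel (g : TangentPairing E M) (x₀ : M) (y u v w : E) : ℝ :=
  (1 / 2) * (fderiv ℝ (fun z => g.inChart x₀ z v w) y u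
    + fderiv ℝ (fun z => g.inChart x₀ z u w) y v
    - fderiv ℝ (fun z => g.inChart x₀ z u v) y w)

/-- `γ` is a geodesic on `J` (an open interval): it is smooth there and it satisfies the geodesic
equation `g(c'', w) + Γ(c', c'; w) = 0` for all `w`, where `c` is `γ` read in the chart around
the point under consideration. For a Riemannian metric this says `g(∇_{γ'} γ', w) = 0` for all `w`,
where `∇` is the Levi-Civita connection, that is `∇_{γ'} γ' = 0`. -/
structure IsGeodesicOn (g : TangentPairing E M) (γ : ℝ → M) (J : Set ℝ) : Prop where
  contMDiffOn : ContMDiffOn 𝓘(ℝ, ℝ) 𝓘(ℝ, E) ∞ γ J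
  equation : ∀ t ∈ J, ∀ w : E,
    g.inChart (γ t) (extChartAt 𝓘(ℝ, E) (γ t) (γ t))
        (deriv (deriv fun s => extChartAt 𝓘(ℝ, E) (γ t) (γ s)) t) w
      + g.christoffel (γ t) (extChartAt 𝓘(ℝ, E) (γ t) (γ t))
        (deriv (fun s => extChartAt 𝓘(ℝ, E) (γ t) (γ s)) t)
        (deriv (fun s => extChartAt 𝓘(ℝ, E) (γ t) (γ s)) t) w = 0

/-- The length `∫₀¹ √(g(γ', γ')) dt` of a curve. -/
def curveLength (g : TangentPairing E M) (γ : ℝ → M) : ℝ :=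
  ∫ t in (0 : ℝ)..1, √(g (γ t) (mfderiv 𝓘(ℝ, ℝ) 𝓘(ℝ, E) γ t (1 : ℝ))
    (mfderiv 𝓘(ℝ, ℝ) 𝓘(ℝ, E) γ t (1 : ℝ)))

/-- `γ` restricted to `[0, 1]` is a `C²` curve of minimal length among all `C²` curves
`[0, 1] → M` with the same end points. -/
structure IsMinimizingGeodesic (g : TangentPairing E M) (γ : ℝ → M) : Prop where
  contMDiffOn : ContMDiffOn 𝓘(ℝ, ℝ) 𝓘(ℝ, E) 2 γ (Icc 0 1)
  minimal : ∀ σ : ℝ → M, ContMDiffOn 𝓘(ℝ, ℝ) 𝓘(ℝ, E) 2 σ (Icc 0 1) → σ 0 = γ 0 → σ 1 = γ 1 →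
    curveLength g γ ≤ curveLength g σ

/-- The subset `S` of the Riemannian manifold `(M, g)` is an (embedded, smooth) totally geodesic
submanifold: with the subspace topology it carries a smooth manifold structure such that the
inclusion is a smooth embedding, and every geodesic of `S` for the induced metric, defined on any
open interval, is a geodesic of `(M, g)`. -/
def IsTotallyGeodesicSubmanifold [IsManifold 𝓘(ℝ, E) ∞ M]
    (g : ContMDiffRiemannianMetric 𝓘(ℝ, E) ∞ E (fun x : M => TangentSpace 𝓘(ℝ, E) x))
    (S : Set M) : Prop :=
  ∃ (F : Type) (_ : NormedAddCommGroup F) (_ : NormedSpace ℝ F) (_ : FiniteDimensional ℝ F)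
    (_ : ChartedSpace F S),
    IsManifold 𝓘(ℝ, F) ∞ S ∧
    IsSmoothEmbedding 𝓘(ℝ, F) 𝓘(ℝ, E) ∞ (Subtype.val : S → M) ∧
    ∀ (J : Set ℝ) (γ : ℝ → S), IsOpen J → J.OrdConnected →
      IsGeodesicOn (TangentPairing.pullback (F := F) (fun x v w => g.inner x v w)
        (Subtype.val : S → M)) γ J →
      IsGeodesicOn (E := E) (fun x v w => g.inner x v w) (fun t => (γ t : M)) J

/-- The variant of `IsTotallyGeodesicSubmanifold` in which a geodesic joining two points means a
`C²` curve on `[0, 1]` of minimal length among all such curves joining these points. -/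
def IsTotallyGeodesicForMinimizers [IsManifold 𝓘(ℝ, E) ∞ M]
    (g : ContMDiffRiemannianMetric 𝓘(ℝ, E) ∞ E (fun x : M => TangentSpace 𝓘(ℝ, E) x))
    (S : Set M) : Prop :=
  ∃ (F : Type) (_ : NormedAddCommGroup F) (_ : NormedSpace ℝ F) (_ : FiniteDimensional ℝ F)
    (_ : ChartedSpace F S),
    IsManifold 𝓘(ℝ, F) ∞ S ∧
    IsSmoothEmbedding 𝓘(ℝ, F) 𝓘(ℝ, E) ∞ (Subtype.val : S → M) ∧
    ∀ γ : ℝ → S,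
      IsMinimizingGeodesic (TangentPairing.pullback (F := F) (fun x v w => g.inner x v w)
        (Subtype.val : S → M)) γ →
      IsMinimizingGeodesic (E := E) (fun x v w => g.inner x v w) (fun t => (γ t : M))

end Riemannian

/-! ### The Euclidean space of symmetric matrices -/

/-- The real symmetric `n × n` matrices, as a subspace of all matrices. -/
def symSubmodule (n : ℕ) : Submodule ℝ (Matrix (Fin n) (Fin n) ℝ) where
  carrier := {A | A.IsSymm}
  add_mem' := fun ha hb => ha.add hb
  zero_mem' := Matrix.isSymm_zero
  smul_mem' := fun c _ h => h.smul c

/-- The space `𝒮_n` of real symmetric `n × n` matrices, with the inner product `trace (A B)`. -/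
def SymMat (n : ℕ) : Type := symSubmodule n

namespace SymMat

variable {n : ℕ}

/-- The linear structure of `𝒮_n`, used to build the inner product space below. -/
abbrev addCommGroupAux (n : ℕ) : AddCommGroup (SymMat n) :=
  inferInstanceAs (AddCommGroup (symSubmodule n))

section InnerProduct

attribute [local instance] addCommGroupAux

/-- The linear structure of `𝒮_n`, used to build the inner product space below. -/
abbrev moduleAux (n : ℕ) : Module ℝ (SymMat n) := inferInstanceAs (Module ℝ (symSubmodule n))

attribute [local instance] moduleAux

/-- The inclusion of symmetric matrices into all matrices. -/
def toMatrixAux (n : ℕ) : SymMat n →ₗ[ℝ] Matrix (Fin n) (Fin n) ℝ := (symSubmodule n).subtype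

theorem trace_mul_self_aux (A : SymMat n) :
    (toMatrixAux n A * toMatrixAux n A).trace = ∑ i, ∑ j, toMatrixAux n A i j ^ 2 := by
  simp only [Matrix.trace, Matrix.diag, Matrix.mul_apply]
  refine Finset.sum_congr rfl fun i _ => Finset.sum_congr rfl fun j _ => ?_
  rw [Matrix.IsSymm.apply (A := toMatrixAux n A) A.2 i j]
  ring

/-- The inner product `trace (A B)`. -/
abbrev innerCore (n : ℕ) : InnerProductSpace.Core ℝ (SymMat n) where
  inner A B := (toMatrixAux n A * toMatrixAux n B).trace
  conj_inner_symm A B := by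
    simpa using Matrix.trace_mul_comm _ _
  re_inner_nonneg A := by
    change 0 ≤ (toMatrixAux n A * toMatrixAux n A).trace
    rw [trace_mul_self_aux]
    positivity
  add_left A B C := by simp [add_mul]
  smul_left A B r := by simp
  definite A h := by
    change (toMatrixAux n A * toMatrixAux n A).trace = 0 at h
    rw [trace_mul_self_aux] at h
    apply Subtype.val_injective
    change toMatrixAux n A = 0
    ext i j
    have h1 := (Finset.sum_eq_zero_iff_of_nonneg fun i _ => by positivity).1 h i (Finset.mem_univ _)
    have h2 := (Finset.sum_eq_zero_iff_of_nonneg fun i _ => by positivity).1 h1 j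
      (Finset.mem_univ _)
    simpa using h2

instance : NormedAddCommGroup (SymMat n) := (innerCore n).toNormedAddCommGroup

instance : InnerProductSpace ℝ (SymMat n) := InnerProductSpace.ofCore (innerCore n).toCore

end InnerProduct

instance : FiniteDimensional ℝ (SymMat n) :=
  inferInstanceAs (FiniteDimensional ℝ (symSubmodule n))

/-- The inclusion of symmetric matrices into all matrices. -/
def toMatrix : SymMat n →ₗ[ℝ] Matrix (Fin n) (Fin n) ℝ := toMatrixAux n

theorem inner_def (A B : SymMat n) : inner ℝ A B = (toMatrix A * toMatrix B).trace := rfl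

theorem toMatrix_isSymm (A : SymMat n) : (toMatrix A).IsSymm := A.2

theorem toMatrix_injective : Function.Injective (toMatrix (n := n)) := Subtype.val_injective

theorem contDiff_entry (i j : Fin n) {k : WithTop ℕ∞} :
    ContDiff ℝ k fun X : SymMat n => toMatrix X i j :=
  (LinearMap.toContinuousLinearMap
    ((LinearMap.proj j ∘ₗ LinearMap.proj i : Matrix (Fin n) (Fin n) ℝ →ₗ[ℝ] ℝ) ∘ₗ toMatrix)).contDiff

end SymMat

/-! ### The cone of positive-definite matrices -/

theorem isOpen_posDef (n : ℕ) : IsOpen {X : SymMat n | (SymMat.toMatrix X).PosDef} := by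
  have hcont : Continuous fun p : (Fin n → ℝ) × SymMat n =>
      ∑ i, ∑ j, p.1 i * (SymMat.toMatrix p.2 i j * p.1 j) := by
    refine continuous_finsetSum _ fun i _ => continuous_finsetSum _ fun j _ => ?_
    have h := (SymMat.contDiff_entry (n := n) i j (k := 0)).continuous
    fun_prop
  have heq : {X : SymMat n | (SymMat.toMatrix X).PosDef}ᶜ =
      Prod.snd '' ((Metric.sphere (0 : Fin n → ℝ) 1 ×ˢ univ) ∩
        {p : (Fin n → ℝ) × SymMat n |
          ∑ i, ∑ j, p.1 i * (SymMat.toMatrix p.2 i j * p.1 j) ≤ 0}) := by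
    ext X
    have hquad : ∀ v : Fin n → ℝ, star v ⬝ᵥ (SymMat.toMatrix X).mulVec v =
        ∑ i, ∑ j, v i * (SymMat.toMatrix X i j * v j) := fun v => by
      simp [dotProduct, Matrix.mulVec, Finset.mul_sum]
    have hsymm : (SymMat.toMatrix X).IsHermitian := by
      simpa [Matrix.IsHermitian, Matrix.conjTranspose] using! SymMat.toMatrix_isSymm X
    simp only [mem_compl_iff, mem_ofPred_eq, Matrix.posDef_iff_dotProduct_mulVec, hsymm, true_and,
      hquad, mem_image, mem_inter_iff, mem_prod, mem_sphere_zero_iff_norm, mem_univ, and_true,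
      Prod.exists, exists_eq_right]
    push Not
    constructor
    · rintro ⟨v, hv, h⟩
      refine ⟨‖v‖⁻¹ • v, by simp [norm_smul, hv], ?_⟩
      have : ∑ i, ∑ j, (‖v‖⁻¹ • v) i * (SymMat.toMatrix X i j * (‖v‖⁻¹ • v) j) =
          (‖v‖⁻¹) ^ 2 * ∑ i, ∑ j, v i * (SymMat.toMatrix X i j * v j) := by
        simp only [Finset.mul_sum, Pi.smul_apply, smul_eq_mul]
        exact Finset.sum_congr rfl fun i _ => Finset.sum_congr rfl fun j _ => by ring
      rw [this]
      exact mul_nonpos_of_nonneg_of_nonpos (by positivity) h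
    · rintro ⟨v, hv, h⟩
      refine ⟨v, ?_, h⟩
      rintro rfl
      simp at hv
  rw [← isClosed_compl_iff, heq]
  have hK : IsCompact (Metric.sphere (0 : Fin n → ℝ) 1) := isCompact_sphere _ _
  have hC : IsClosed {p : (Fin n → ℝ) × SymMat n |
      ∑ i, ∑ j, p.1 i * (SymMat.toMatrix p.2 i j * p.1 j) ≤ 0} :=
    isClosed_le hcont continuous_const
  have : CompactSpace (Metric.sphere (0 : Fin n → ℝ) 1) := isCompact_iff_compactSpace.1 hK
  have h2 : IsClosed (Prod.snd '' {q : Metric.sphere (0 : Fin n → ℝ) 1 × SymMat n |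
      ((q.1 : Fin n → ℝ), q.2) ∈ {p : (Fin n → ℝ) × SymMat n |
        ∑ i, ∑ j, p.1 i * (SymMat.toMatrix p.2 i j * p.1 j) ≤ 0}}) :=
    isClosedMap_snd_of_compactSpace _ (hC.preimage (by fun_prop))
  convert h2 using 1
  ext X
  simp only [mem_image, mem_inter_iff, mem_prod, mem_univ, and_true, mem_ofPred_eq, Prod.exists,
    exists_eq_right, Subtype.exists, exists_prop]

/-- The set `𝒫_n` of symmetric positive-definite `n × n` matrices, an open subset of `𝒮_n`; as
such it is a manifold whose tangent spaces are `𝒮_n`. -/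
def PosDefCone (n : ℕ) : TopologicalSpace.Opens (SymMat n) :=
  ⟨{X | (SymMat.toMatrix X).PosDef}, isOpen_posDef n⟩

namespace PosDefCone

variable {n : ℕ}

/-- The matrix underlying a point of `𝒫_n`. -/
def mat (X : PosDefCone n) : Matrix (Fin n) (Fin n) ℝ := SymMat.toMatrix (X : SymMat n)

theorem mat_posDef (X : PosDefCone n) : (mat X).PosDef := X.2

end PosDefCone

/-- The bilinear form
`g_X(A, B) = (det X)^β (trace (X⁻¹ A X⁻¹ B) - β trace (X⁻¹ A) trace (X⁻¹ B))` on `𝒮_n`. -/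
def betaForm (n : ℕ) (β : ℝ) (X : Matrix (Fin n) (Fin n) ℝ) :
    SymMat n →ₗ[ℝ] SymMat n →ₗ[ℝ] ℝ :=
  LinearMap.mk₂ ℝ
    (fun A B => X.det ^ β * ((X⁻¹ * A.toMatrix * X⁻¹ * B.toMatrix).trace
      - β * (X⁻¹ * A.toMatrix).trace * (X⁻¹ * B.toMatrix).trace))
    (fun A A' B => by simp only [map_add, mul_add, add_mul, Matrix.trace_add]; ring)
    (fun c A B => by
      simp only [map_smul, Matrix.mul_smul, Matrix.smul_mul, Matrix.trace_smul, smul_eq_mul]; ring)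
    (fun A B B' => by simp only [map_add, mul_add, Matrix.trace_add]; ring)
    (fun c A B => by
      simp only [map_smul, Matrix.mul_smul, Matrix.trace_smul, smul_eq_mul]; ring)

theorem betaForm_symm (n : ℕ) (β : ℝ) (X : Matrix (Fin n) (Fin n) ℝ) (A B : SymMat n) :
    betaForm n β X A B = betaForm n β X B A := by
  simp only [betaForm, LinearMap.mk₂_apply]
  rw [Matrix.mul_assoc (X⁻¹ * A.toMatrix), Matrix.trace_mul_comm (X⁻¹ * A.toMatrix),
    ← Matrix.mul_assoc]
  ring

theorem trace_sq_le (n : ℕ) (S : Matrix (Fin n) (Fin n) ℝ) :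
    S.trace ^ 2 ≤ n * ∑ i, ∑ j, S i j ^ 2 := by
  have h1 : S.trace ^ 2 ≤ n * ∑ i, S i i ^ 2 := by
    simpa [Matrix.trace] using sq_sum_le_card_mul_sum_sq (s := Finset.univ) (f := fun i => S i i)
  have h2 : ∑ i, S i i ^ 2 ≤ ∑ i, ∑ j, S i j ^ 2 :=
    Finset.sum_le_sum fun i _ =>
      Finset.single_le_sum (f := fun j => S i j ^ 2) (fun j _ => sq_nonneg _) (Finset.mem_univ i)
  exact h1.trans (mul_le_mul_of_nonneg_left h2 n.cast_nonneg)

open scoped MatrixOrder Matrix.Norms.L2Operator in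
theorem exists_eq_star_mul_self_of_posDef {n : ℕ} {Y : Matrix (Fin n) (Fin n) ℝ} (hY : Y.PosDef) :
    ∃ B : Matrix (Fin n) (Fin n) ℝ, IsUnit B ∧ Y = star B * B :=
  CStarAlgebra.isStrictlyPositive_iff_eq_star_mul_self.1 hY.isStrictlyPositive

theorem betaForm_pos (n : ℕ) (β : ℝ) (hβ : β < 1 / n) {X : Matrix (Fin n) (Fin n) ℝ}
    (hX : X.PosDef) {A : SymMat n} (hA : A ≠ 0) : 0 < betaForm n β X A A := by
  obtain ⟨B, hB, hXB⟩ : ∃ B : Matrix (Fin n) (Fin n) ℝ, IsUnit B ∧ X⁻¹ = B.transpose * B := by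
    obtain ⟨B, hB, h⟩ := exists_eq_star_mul_self_of_posDef hX.inv
    exact ⟨B, hB, by simpa [Matrix.star_eq_conjTranspose, Matrix.conjTranspose] using! h⟩
  have hdet : IsUnit B.det := (Matrix.isUnit_iff_isUnit_det _).1 hB
  have hdetT : IsUnit B.transpose.det := by rwa [Matrix.det_transpose]
  set S := B * A.toMatrix * B.transpose with hS
  have hSsymm : S.transpose = S := by
    simp [hS, Matrix.transpose_mul, Matrix.mul_assoc, (SymMat.toMatrix_isSymm A).eq]
  have h1 : (X⁻¹ * A.toMatrix).trace = S.trace := by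
    rw [hXB, hS, Matrix.mul_assoc, Matrix.trace_mul_comm]
  have h2 : (X⁻¹ * A.toMatrix * X⁻¹ * A.toMatrix).trace = ∑ i, ∑ j, S i j ^ 2 := by
    have : (X⁻¹ * A.toMatrix * X⁻¹ * A.toMatrix).trace = (S * S).trace := by
      rw [hXB, hS]
      simp only [Matrix.mul_assoc]
      rw [Matrix.trace_mul_comm]
      simp only [Matrix.mul_assoc]
    rw [this]
    simp only [Matrix.trace, Matrix.diag, Matrix.mul_apply]
    refine Finset.sum_congr rfl fun i _ => Finset.sum_congr rfl fun j _ => ?_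
    rw [show S j i = S i j from congrFun (congrFun hSsymm i) j]
    ring
  have hpos : 0 < ∑ i, ∑ j, S i j ^ 2 := by
    refine lt_of_le_of_ne (by positivity) fun h0 => hA ?_
    have hS0 : S = 0 := by
      ext i j
      have h1 := (Finset.sum_eq_zero_iff_of_nonneg fun i _ => by positivity).1 h0.symm i
        (Finset.mem_univ _)
      have h2 := (Finset.sum_eq_zero_iff_of_nonneg fun i _ => by positivity).1 h1 j
        (Finset.mem_univ _)
      simpa using h2
    apply SymMat.toMatrix_injective
    have : A.toMatrix = B⁻¹ * S * B.transpose⁻¹ := by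
      rw [hS, Matrix.mul_assoc, Matrix.mul_assoc, Matrix.mul_assoc, Matrix.mul_nonsing_inv _ hdetT,
        Matrix.mul_one, ← Matrix.mul_assoc, Matrix.nonsing_inv_mul _ hdet, Matrix.one_mul]
    rw [this, hS0]
    simp
  have hle := trace_sq_le n S
  simp only [betaForm, LinearMap.mk₂_apply, h1, h2]
  refine mul_pos (Real.rpow_pos_of_pos hX.det_pos _) ?_
  rcases le_or_gt β 0 with h | h
  · nlinarith [mul_nonneg (neg_nonneg.2 h) (sq_nonneg S.trace)]
  · have hn : (0 : ℝ) < n := by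
      rcases Nat.eq_zero_or_pos n with rfl | hn
      · norm_num at hβ
        linarith
      · exact_mod_cast hn
    have hβn : β * n < 1 := by rwa [lt_div_iff₀ hn] at hβ
    nlinarith [mul_le_mul_of_nonneg_left hle h.le, mul_pos (sub_pos.2 hβn) hpos]

theorem contDiffOn_det {n m : ℕ} {s : Set (SymMat n)}
    {f : SymMat n → Matrix (Fin m) (Fin m) ℝ}
    (hf : ∀ i j, ContDiffOn ℝ ∞ (fun X => f X i j) s) :
    ContDiffOn ℝ ∞ (fun X => (f X).det) s := by
  simp only [Matrix.det_apply]
  exact ContDiffOn.sum fun σ _ => ContDiffOn.const_smul _ (contDiffOn_prod fun i _ => hf _ _)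

theorem contDiffOn_inv_entry (n : ℕ) (i j : Fin n) :
    ContDiffOn ℝ ∞ (fun X : SymMat n => (SymMat.toMatrix X)⁻¹ i j) (PosDefCone n) := by
  have hdet : ContDiffOn ℝ ∞ (fun X : SymMat n => (SymMat.toMatrix X).det) (PosDefCone n) :=
    contDiffOn_det fun i j => (SymMat.contDiff_entry i j).contDiffOn
  have hadj : ContDiffOn ℝ ∞ (fun X : SymMat n => (SymMat.toMatrix X).adjugate i j)
      (PosDefCone n) := by
    simp only [Matrix.adjugate_apply]
    refine contDiffOn_det fun k l => ?_
    by_cases hk : k = j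
    · subst hk
      simpa using contDiffOn_const
    · simpa [Matrix.updateRow_ne hk] using (SymMat.contDiff_entry k l).contDiffOn
  have : (fun X : SymMat n => (SymMat.toMatrix X)⁻¹ i j) =
      fun X => ((SymMat.toMatrix X).det)⁻¹ * (SymMat.toMatrix X).adjugate i j := by
    ext X
    simp [Matrix.inv_def]
  rw [this]
  exact (hdet.inv fun X hX => (Matrix.PosDef.det_pos hX).ne').mul hadj

theorem contDiffOn_betaForm (n : ℕ) (β : ℝ) (A B : SymMat n) :
    ContDiffOn ℝ ∞ (fun X : SymMat n => betaForm n β (SymMat.toMatrix X) A B) (PosDefCone n) := by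
  have hdet : ContDiffOn ℝ ∞ (fun X : SymMat n => (SymMat.toMatrix X).det) (PosDefCone n) :=
    contDiffOn_det fun i j => (SymMat.contDiff_entry i j).contDiffOn
  have hinv := contDiffOn_inv_entry n
  simp only [betaForm, LinearMap.mk₂_apply, Matrix.trace, Matrix.diag, Matrix.mul_apply]
  refine (hdet.rpow_const_of_ne fun X hX => (Matrix.PosDef.det_pos hX).ne').mul ?_
  refine ContDiffOn.sub ?_ (ContDiffOn.mul (ContDiffOn.mul contDiffOn_const ?_) ?_)
  · refine ContDiffOn.sum fun i _ => ContDiffOn.sum fun j _ => ContDiffOn.mul ?_ contDiffOn_const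
    refine ContDiffOn.sum fun k _ => ContDiffOn.mul ?_ (hinv _ _)
    exact ContDiffOn.sum fun l _ => ContDiffOn.mul (hinv _ _) contDiffOn_const
  · exact ContDiffOn.sum fun i _ => ContDiffOn.sum fun j _ => (hinv _ _).mul contDiffOn_const
  · exact ContDiffOn.sum fun i _ => ContDiffOn.sum fun j _ => (hinv _ _).mul contDiffOn_const

theorem isVonNBounded_of_pos {V : Type*} [NormedAddCommGroup V] [NormedSpace ℝ V]
    [FiniteDimensional ℝ V] (b : V →L[ℝ] V →L[ℝ] ℝ) (hb : ∀ v, v ≠ 0 → 0 < b v v) :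
    Bornology.IsVonNBounded ℝ {v : V | b v v < 1} := by
  have : ProperSpace V := FiniteDimensional.proper ℝ V
  rw [NormedSpace.isVonNBounded_iff]
  rcases subsingleton_or_nontrivial V with hV | hV
  · exact (Set.subsingleton_of_subsingleton.finite (s := {v : V | b v v < 1})).isBounded
  have hcont : Continuous fun v : V => b v v := by fun_prop
  obtain ⟨u, hu, hmin⟩ := (isCompact_sphere (0 : V) 1).exists_isMinOn
    (NormedSpace.sphere_nonempty.2 zero_le_one) hcont.continuousOn
  have hu0 : u ≠ 0 := by
    rintro rfl
    simp at hu
  have hc := hb u hu0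
  refine (Metric.isBounded_closedBall (x := (0 : V)) (r := 1 + (b u u)⁻¹)).subset fun v hv => ?_
  rw [mem_closedBall_zero_iff]
  by_contra! hlt
  have hv0 : 0 < ‖v‖ := lt_trans (by positivity) hlt
  have h1 : b u u ≤ b (‖v‖⁻¹ • v) (‖v‖⁻¹ • v) :=
    hmin (by simp [norm_smul, hv0.ne'])
  simp only [map_smul, smul_apply, smul_eq_mul] at h1
  have h2 : b u u * ‖v‖ ^ 2 ≤ b v v := by
    have := mul_le_mul_of_nonneg_right h1 (sq_nonneg ‖v‖)
    field_simp at this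
    linarith
  have h3 : b v v < 1 := hv
  have h4 : 1 < b u u * ‖v‖ := by
    have := mul_lt_mul_of_pos_left hlt hc
    have h5 : b u u * (1 + (b u u)⁻¹) = b u u + 1 := by field_simp
    linarith
  have h5 : 1 ≤ ‖v‖ := by
    have : 0 < (b u u)⁻¹ := by positivity
    linarith
  nlinarith

theorem coordChange_opens {V : Type*} [NormedAddCommGroup V] [NormedSpace ℝ V]
    (U : TopologicalSpace.Opens V) (a b x : U) :
    (tangentBundleCore 𝓘(ℝ, V) U).coordChange (achart V a) (achart V b) x =
      ContinuousLinearMap.id ℝ V := by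
  rw [tangentBundleCore_coordChange_achart]
  have hab : chartAt V a = chartAt V b := rfl
  ext v
  have h := tangentCoordChange_self (I := 𝓘(ℝ, V)) (x := a) (z := x) (v := v)
    (by simp [extChartAt, TopologicalSpace.Opens.chartAt_eq, chartAt_self_eq])
  exact h

theorem contMDiff_section_opens {V : Type*} [NormedAddCommGroup V] [NormedSpace ℝ V]
    (U : TopologicalSpace.Opens V) (b : U → V →L[ℝ] V →L[ℝ] ℝ)
    (hb : ContMDiff 𝓘(ℝ, V) 𝓘(ℝ, V →L[ℝ] V →L[ℝ] ℝ) ∞ b) :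
    ContMDiff 𝓘(ℝ, V) (𝓘(ℝ, V).prod 𝓘(ℝ, V →L[ℝ] V →L[ℝ] ℝ)) ∞
      (fun x => TotalSpace.mk' (V →L[ℝ] V →L[ℝ] ℝ)
        (E := fun x : U => TangentSpace 𝓘(ℝ, V) x →L[ℝ] TangentSpace 𝓘(ℝ, V) x →L[ℝ] ℝ) x (b x)) := by
  intro x
  refine (contMDiffAt_section x).2 ?_
  have key : ∀ y : U, (trivializationAt (V →L[ℝ] V →L[ℝ] ℝ)
      (fun x : U => TangentSpace 𝓘(ℝ, V) x →L[ℝ] TangentSpace 𝓘(ℝ, V) x →L[ℝ] ℝ) x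
        ⟨y, b y⟩).2 = b y := by
    intro y
    have hy : y ∈ (chartAt V x).source := by
      simp [TopologicalSpace.Opens.chartAt_eq, chartAt_self_eq]
    refine (congrArg Prod.snd (hom_trivializationAt_apply (RingHom.id ℝ) x _)).trans ?_
    ext v w
    have e1 : (trivializationAt V (TangentSpace 𝓘(ℝ, V)) x).symmL ℝ y = ContinuousLinearMap.id ℝ V :=
      (TangentBundle.symmL_trivializationAt_eq_core hy).trans (coordChange_opens U x y y)
    have e2 : ∀ L : TangentSpace 𝓘(ℝ, V) y →L[ℝ] ℝ,
        ((trivializationAt (V →L[ℝ] ℝ) (fun x : U => TangentSpace 𝓘(ℝ, V) x →L[ℝ] ℝ)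
          x).continuousLinearMapAt ℝ y L : V →L[ℝ] ℝ) w = L w := by
      intro L
      rw [Trivialization.continuousLinearMapAt_apply, Trivialization.linearMapAt_apply]
      rw [if_pos (by simpa using hy)]
      refine (congrArg (fun p => p.2 w) (hom_trivializationAt_apply (RingHom.id ℝ)
        (E₁ := fun x : U => TangentSpace 𝓘(ℝ, V) x) 
        (F₁ := V) (F₂ := ℝ) (E₂ := Bundle.Trivial U ℝ) x ⟨y, L⟩)).trans ?_
      simp only [ContinuousLinearMap.inCoordinates]
      refine Eq.trans (b := L ((trivializationAt V (TangentSpace 𝓘(ℝ, V)) x).symmL ℝ y w)) ?_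
        (congrArg (fun T : V →L[ℝ] V => L (T w)) e1)
      simp
    refine Eq.trans (e2 _) ?_
    exact congrArg (fun T : V →L[ℝ] V => b y (T v) w) e1
  exact (hb x).congr_of_eventuallyEq (Filter.Eventually.of_forall key)

theorem contMDiff_betaForm (n : ℕ) (β : ℝ) :
    ContMDiff 𝓘(ℝ, SymMat n) 𝓘(ℝ, SymMat n →L[ℝ] SymMat n →L[ℝ] ℝ) ∞
      fun X : PosDefCone n => (betaForm n β (PosDefCone.mat X)).toContinuousBilinearMap := by
  have h : ContDiffOn ℝ ∞ (fun X : SymMat n =>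
      (betaForm n β (SymMat.toMatrix X)).toContinuousBilinearMap) (PosDefCone n) := by
    refine contDiffOn_clm_apply.2 fun A => contDiffOn_clm_apply.2 fun B => ?_
    exact contDiffOn_betaForm n β A B
  exact h.contMDiffOn.comp_contMDiff contMDiff_subtype_val fun X => X.2

/-- The Riemannian manifold `ℳ_n^β`: the metric
`g_X(A, B) = (det X)^β (trace (X⁻¹ A X⁻¹ B) - β trace (X⁻¹ A) trace (X⁻¹ B))` on `𝒫_n`, as a smooth
Riemannian metric. -/
def betaMetric (n : ℕ) (β : ℝ) (hβ : β < 1 / n) :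
    ContMDiffRiemannianMetric 𝓘(ℝ, SymMat n) ∞ (SymMat n)
      (fun X : PosDefCone n => TangentSpace 𝓘(ℝ, SymMat n) X) where
  inner X := (betaForm n β (PosDefCone.mat X)).toContinuousBilinearMap
  symm X A B := betaForm_symm n β (PosDefCone.mat X) A B
  pos X _ hA := betaForm_pos n β hβ (PosDefCone.mat_posDef X) hA
  isVonNBounded X := isVonNBounded_of_pos (betaForm n β (PosDefCone.mat X)).toContinuousBilinearMap
    fun _ hA => betaForm_pos n β hβ (PosDefCone.mat_posDef X) hA
  contMDiff := contMDiff_section_opens (PosDefCone n) _ (contMDiff_betaForm n β)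

/-- The positive-definite diagonal matrices. -/
def posDiagonal (n : ℕ) : Set (PosDefCone n) := {X | (PosDefCone.mat X).IsDiag}

/-- The positive scalar matrices `α I`, `α > 0`. -/
def posScalar (n : ℕ) : Set (PosDefCone n) :=
  {X | ∃ α : ℝ, 0 < α ∧ PosDefCone.mat X = α • (1 : Matrix (Fin n) (Fin n) ℝ)}

end

/-!
Both sets are intersections of the cone `𝒫_n` with a linear subspace of `𝒮_n`, so a linear
coordinate on the subspace is a global chart of the submanifold (`IsLinearSlice`), and geodesics and
lengths can be computed in the ambient vector space.

For solutions of the geodesic equation (`IsLinearSlice.isGeodesicOn_of_orthogonal`), split `𝒮_n`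
into the subspace and its orthogonal complement for the trace form. The subspace is closed under
products and inverses. Hence, at a point `X` of the submanifold and for `A` tangent to it, a vector
`K` of the complement satisfies `trace (X⁻¹ K) = 0`, `g_X(A, K) = 0` and `∂_K g(A, A) = 0`. So the
geodesic equation tested against `K` is trivial, and tested against tangent vectors it is the
intrinsic geodesic equation.

For shortest curves (`IsLinearSlice.isMinimizingGeodesic_of_retraction`), it is enough to have a
smooth retraction of `𝒫_n` onto the submanifold that does not increase the length of tangent
vectors. The congruence by `T`, where `X = T Tᵀ` and `A = T S Tᵀ`, gives
`g_X(A, A) = (det X)^β (∑ S_ij² - β (trace S)²)` (`betaForm_self_of_congruence`).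
* For the diagonal matrices take `T` lower triangular (Cholesky) and map `X` to the diagonal matrix
  with entries `T_ii²`. These are quotients of leading minors of `X`, hence smooth, and their
  logarithmic derivatives along `A` are `S_ii` (`hasDerivAt_choleskyDiag_line`). So the retraction
  preserves `det X` and `trace S`, and replaces `∑ S_ij²` by `∑ S_ii²`.
* For the scalar matrices map `X` to `(det X)^(1/n) I`. This preserves `det X` and `trace S`, and
  replaces `∑ S_ij²` by `(trace S)² / n`.
-/

/-! ### Manifolds with a global chart -/

section GlobalChart

/-- Every preferred chart of the manifold `M` is the globally defined map `c : M → E`. -/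
def IsGlobalChart {E : Type*} [NormedAddCommGroup E] {M : Type*} [TopologicalSpace M]
    [ChartedSpace E M] (c : M → E) : Prop :=
  ∀ x : M, (chartAt E x).source = univ ∧ ⇑(chartAt E x) = c

theorem isGlobalChart_id {E : Type*} [NormedAddCommGroup E] : IsGlobalChart (id : E → E) :=
  fun x => by simp [chartAt_self_eq]

theorem isGlobalChart_opens {E : Type*} [NormedAddCommGroup E] (U : TopologicalSpace.Opens E) :
    IsGlobalChart (Subtype.val : U → E) := fun x => by
  constructor
  · simp [TopologicalSpace.Opens.chartAt_eq, chartAt_self_eq]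
  · ext y
    simp [TopologicalSpace.Opens.chartAt_eq, chartAt_self_eq]

variable {E : Type*} [NormedAddCommGroup E] [NormedSpace ℝ E]
  {M : Type*} [TopologicalSpace M] [ChartedSpace E M]
  {F : Type*} [NormedAddCommGroup F] [NormedSpace ℝ F]
  {N : Type*} [TopologicalSpace N] [ChartedSpace F N]

namespace IsGlobalChart

variable {c : M → E} (hc : IsGlobalChart c) {d : N → F}

include hc

theorem extChartAt_apply (x₀ x : M) : extChartAt 𝓘(ℝ, E) x₀ x = c x := by
  simp [extChartAt, (hc x₀).2]

theorem extChartAt_symm_apply (x₀ x : M) : (extChartAt 𝓘(ℝ, E) x₀).symm (c x) = x := by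
  rw [← hc.extChartAt_apply x₀]
  exact (extChartAt 𝓘(ℝ, E) x₀).left_inv (by simp [(hc x₀).1])

theorem target_eq (x₀ : M) : (extChartAt 𝓘(ℝ, E) x₀).target = range c := by
  ext y
  constructor
  · intro hy
    exact ⟨_, by rw [← hc.extChartAt_apply x₀, (extChartAt 𝓘(ℝ, E) x₀).right_inv hy]⟩
  · rintro ⟨x, rfl⟩
    rw [← hc.extChartAt_apply x₀]
    exact (extChartAt 𝓘(ℝ, E) x₀).map_source (by simp [(hc x₀).1])

theorem apply_extChartAt_symm (x₀ : M) {y : E} (hy : y ∈ range c) :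
    c ((extChartAt 𝓘(ℝ, E) x₀).symm y) = y := by
  obtain ⟨x, rfl⟩ := hy
  rw [hc.extChartAt_symm_apply]

theorem isOpen_range : IsOpen (range c) := by
  rcases isEmpty_or_nonempty M with hM | ⟨⟨x₀⟩⟩
  · rw [range_eq_empty]
    exact isOpen_empty
  · rw [← hc.target_eq x₀]
    exact isOpen_extChartAt_target x₀

theorem contMDiff [IsManifold 𝓘(ℝ, E) ∞ M] : ContMDiff 𝓘(ℝ, E) 𝓘(ℝ, E) ∞ c := by
  intro x
  have h := contMDiffAt_extChartAt (I := 𝓘(ℝ, E)) (n := ∞) (x := x)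
  rwa [show ⇑(extChartAt 𝓘(ℝ, E) x) = c from funext (hc.extChartAt_apply x)] at h

theorem contMDiffOn_symm [IsManifold 𝓘(ℝ, E) ∞ M] (x₀ : M) :
    ContMDiffOn 𝓘(ℝ, E) 𝓘(ℝ, E) ∞ (extChartAt 𝓘(ℝ, E) x₀).symm (range c) := by
  rw [← hc.target_eq x₀]
  exact contMDiffOn_extChartAt_symm x₀

theorem contMDiffOn_iff [IsManifold 𝓘(ℝ, E) ∞ M] {f : F → M} {s : Set F} {n : ℕ∞} :
    ContMDiffOn 𝓘(ℝ, F) 𝓘(ℝ, E) n f s ↔ ContDiffOn ℝ n (c ∘ f) s := by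
  have hn : (n : WithTop ℕ∞) ≤ ∞ := by exact_mod_cast le_top
  constructor
  · intro h
    exact contMDiffOn_iff_contDiffOn.1 ((hc.contMDiff.of_le hn).comp_contMDiffOn h)
  · intro h
    have h2 := ((hc.contMDiffOn_symm (f 0)).of_le hn).comp
      (contMDiffOn_iff_contDiffOn.2 h) fun x _ => mem_range_self _
    refine h2.congr fun x _ => ?_
    rw [Function.comp_apply, Function.comp_apply, hc.extChartAt_symm_apply]

/-- Differentiability between manifolds with global charts is differentiability in these charts. -/
theorem hasMFDerivAt_iff_of_global {f : M → N} (hd : IsGlobalChart d) {x : M} {L : E →L[ℝ] F} :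
    HasMFDerivAt 𝓘(ℝ, E) 𝓘(ℝ, F) f x L ↔ ContinuousAt f x ∧
      HasFDerivAt (d ∘ f ∘ (extChartAt 𝓘(ℝ, E) x).symm) L (c x) := by
  unfold HasMFDerivAt
  rw [hc.extChartAt_apply]
  simp only [writtenInExtChartAt, modelWithCornersSelf_coe, range_id]
  rw [show ⇑(extChartAt 𝓘(ℝ, F) (f x)) = d from funext (hd.extChartAt_apply (f x))]
  exact and_congr_right fun _ => hasFDerivWithinAt_univ

/-- In global charts the derivative of a map that reads as a linear map is this linear map. -/
theorem hasMFDerivAt_of_linear {f : M → N} (hd : IsGlobalChart d) (hf : Continuous f)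
    {L : E →L[ℝ] F} (hL : ∀ x, d (f x) = L (c x)) (x : M) :
    HasMFDerivAt 𝓘(ℝ, E) 𝓘(ℝ, F) f x L := by
  refine (hc.hasMFDerivAt_iff_of_global hd).2 ⟨hf.continuousAt, ?_⟩
  refine L.hasFDerivAt.congr_of_eventuallyEq ?_
  filter_upwards [hc.isOpen_range.mem_nhds (mem_range_self x)] with y hy
  rw [Function.comp_apply, Function.comp_apply, hL, hc.apply_extChartAt_symm x hy]

theorem hasMFDerivAt_symm (x₀ : M) {y : E} (hy : y ∈ range c) :
    HasMFDerivAt 𝓘(ℝ, E) 𝓘(ℝ, E) (extChartAt 𝓘(ℝ, E) x₀).symm y (ContinuousLinearMap.id ℝ E) := by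
  refine (isGlobalChart_id.hasMFDerivAt_iff_of_global hc).2 ⟨?_, ?_⟩
  · refine (continuousOn_extChartAt_symm x₀).continuousAt ?_
    rw [hc.target_eq]
    exact hc.isOpen_range.mem_nhds hy
  · refine (hasFDerivAt_id y).congr_of_eventuallyEq ?_
    filter_upwards [hc.isOpen_range.mem_nhds hy] with z hz
    simp only [extChartAt_model_space_eq_id, PartialEquiv.refl_symm, PartialEquiv.refl_coe,
      CompTriple.comp_eq, Function.comp_apply, id_eq]
    exact hc.apply_extChartAt_symm x₀ hz

theorem inChart_eq (g : TangentPairing E M) (x₀ : M) {y : E} (hy : y ∈ range c) (v w : E) :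
    g.inChart x₀ y v w = g ((extChartAt 𝓘(ℝ, E) x₀).symm y) v w := by
  unfold TangentPairing.inChart TangentPairing.pullback
  rw [(hc.hasMFDerivAt_symm x₀ hy).mfderiv]
  rfl

theorem hasMFDerivAt_curve {γ : ℝ → M} {t : ℝ} (hγ : ContinuousAt γ t)
    (h : DifferentiableAt ℝ (c ∘ γ) t) :
    HasMFDerivAt 𝓘(ℝ, ℝ) 𝓘(ℝ, E) γ t
      (ContinuousLinearMap.toSpanSingleton ℝ (deriv (c ∘ γ) t)) :=
  (isGlobalChart_id.hasMFDerivAt_iff_of_global hc).2 ⟨hγ, h.hasDerivAt.hasFDerivAt⟩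

/-- In a global chart the velocity of a curve is the derivative of the curve read in the chart. -/
theorem mfderiv_curve {γ : ℝ → M} {t : ℝ} (hγ : ContinuousAt γ t)
    (h : DifferentiableAt ℝ (c ∘ γ) t) :
    mfderiv 𝓘(ℝ, ℝ) 𝓘(ℝ, E) γ t (1 : ℝ) = deriv (c ∘ γ) t := by
  rw [(hc.hasMFDerivAt_curve hγ h).mfderiv]
  exact (ContinuousLinearMap.toSpanSingleton_apply ℝ _ _).trans (one_smul _ _)

end IsGlobalChart

end GlobalChart

/-! ### Linear slices of an open subset of a vector space -/

section Slice

variable {V : Type*} [NormedAddCommGroup V] [NormedSpace ℝ V]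
  {F : Type*} [NormedAddCommGroup F] [NormedSpace ℝ F]

/-- `S` is the intersection of the open set `U` with the range of the linear map `ι`, and `p` is a
linear left inverse of `ι`. -/
structure IsLinearSlice (U : TopologicalSpace.Opens V) (S : Set U) (ι : F →L[ℝ] V)
    (p : V →L[ℝ] F) : Prop where
  leftInverse : ∀ u, p (ι u) = u
  mem_iff : ∀ x : U, x ∈ S ↔ ι (p x) = x

namespace IsLinearSlice

variable {U : TopologicalSpace.Opens V} {S : Set U} {ι : F →L[ℝ] V} {p : V →L[ℝ] F}
  (h : IsLinearSlice U S ι p)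

include h

theorem apply_coord (x : S) : ι (p ((x : U) : V)) = ((x : U) : V) := (h.mem_iff x).1 x.2

theorem range_coord : range (fun x : S => p ((x : U) : V)) = ι ⁻¹' (U : Set V) := by
  ext u
  constructor
  · rintro ⟨x, rfl⟩
    simp [h.apply_coord x]
  · intro hu
    exact ⟨⟨⟨ι u, hu⟩, (h.mem_iff _).2 (by simp [h.leftInverse])⟩, by simp [h.leftInverse]⟩

theorem isOpenEmbedding_coord : IsOpenEmbedding fun x : S => p ((x : U) : V) := by
  refine ⟨?_, ?_⟩
  · refine IsEmbedding.of_comp (by fun_prop) ι.continuous ?_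
    have : (⇑ι ∘ fun x : S => p ((x : U) : V)) = fun x : S => ((x : U) : V) :=
      funext h.apply_coord
    rw [this]
    exact IsEmbedding.subtypeVal.comp IsEmbedding.subtypeVal
  · rw [h.range_coord]
    exact U.isOpen.preimage ι.continuous

/-- The manifold structure of a linear slice: its only chart is the linear coordinate `p`. -/
@[reducible] noncomputable def chartedSpace [Nonempty S] : ChartedSpace F S :=
  h.isOpenEmbedding_coord.singletonChartedSpace

theorem isGlobalChart [Nonempty S] :
    letI := h.chartedSpace
    IsGlobalChart fun x : S => p ((x : U) : V) := by
  let := h.chartedSpace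
  intro x
  exact ⟨OpenPartialHomeomorph.singletonChartedSpace_chartAt_source _ (by simp),
    h.isOpenEmbedding_coord.singletonChartedSpace_chartAt_eq⟩

theorem isManifold [Nonempty S] :
    letI := h.chartedSpace
    IsManifold 𝓘(ℝ, F) ∞ S :=
  h.isOpenEmbedding_coord.isManifold_singleton

/-- The linear coordinate splits the ambient space as the model of the slice times `ker p`. -/
noncomputable def splitting : (F × p.ker) ≃L[ℝ] V :=
  ContinuousLinearEquiv.equivOfInverse
    (ι.coprod p.ker.subtypeL)
    (p.prod ((ContinuousLinearMap.id ℝ V - ι ∘L p).codRestrict p.ker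
      fun v => by simp [h.leftInverse]))
    (fun u => by
      ext <;> simp [h.leftInverse])
    (fun v => by simp)

theorem isSmoothEmbedding [Nonempty S] :
    letI := h.chartedSpace
    IsSmoothEmbedding 𝓘(ℝ, F) 𝓘(ℝ, V) ∞ (Subtype.val : S → U) := by
  let := h.chartedSpace
  have := h.isManifold
  have hS := h.isGlobalChart
  -- In the global charts the inclusion reads `u ↦ ι u`, which is `u ↦ (u, 0)` after the splitting.
  refine ⟨IsImmersionOfComplement.isImmersion (F := p.ker) fun x => ?_, IsEmbedding.subtypeVal⟩
  refine IsImmersionAtOfComplement.mk_of_continuousAt continuous_subtype_val.continuousAt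
    h.splitting (chartAt F x) (chartAt V (x : U)) (mem_chart_source _ _) (mem_chart_source _ _)
    (IsManifold.chart_mem_maximalAtlas x) (IsManifold.chart_mem_maximalAtlas (x : U)) ?_
  intro y hy
  have hy' : y ∈ range fun x : S => p ((x : U) : V) := by
    rw [← hS.target_eq x]
    exact hy
  obtain ⟨z, rfl⟩ := hy'
  have h1 : ((chartAt F x).extend 𝓘(ℝ, F)).symm (p ((z : U) : V)) = z :=
    hS.extChartAt_symm_apply x z
  have h2 : ∀ w : U, (chartAt V (x : U)).extend 𝓘(ℝ, V) w = w :=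
    (isGlobalChart_opens U).extChartAt_apply (x : U)
  simp only [Function.comp_apply, h1, h2]
  rw [← h.apply_coord z]
  simp [splitting, h.leftInverse]

end IsLinearSlice

end Slice

/-! ### Geodesics and length in a global chart -/

section GlobalChartMetric

variable {E : Type*} [NormedAddCommGroup E] [NormedSpace ℝ E]
  {M : Type*} [TopologicalSpace M] [ChartedSpace E M]

namespace IsGlobalChart

variable {c : M → E} (hc : IsGlobalChart c) {g : TangentPairing E M} {B : E → E → E → ℝ}
  (hB : ∀ x v w, g x v w = B (c x) v w)

include hc hB

theorem inChart_eq_of_eq (x₀ : M) {y : E} (hy : y ∈ range c) (v w : E) :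
    g.inChart x₀ y v w = B y v w := by
  rw [hc.inChart_eq g x₀ hy]
  refine (hB _ v w).trans ?_
  rw [hc.apply_extChartAt_symm x₀ hy]

theorem christoffel_eq_of_eq (x₀ : M) {y : E} (hy : y ∈ range c) (u v w : E) :
    g.christoffel x₀ y u v w = (1 / 2) * (fderiv ℝ (fun z => B z v w) y u
      + fderiv ℝ (fun z => B z u w) y v - fderiv ℝ (fun z => B z u v) y w) := by
  have key : ∀ a b : E, fderiv ℝ (fun z => g.inChart x₀ z a b) y = fderiv ℝ (fun z => B z a b) y :=
    fun a b => Filter.EventuallyEq.fderiv_eq <| by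
      filter_upwards [hc.isOpen_range.mem_nhds hy] with z hz
      exact hc.inChart_eq_of_eq hB x₀ hz a b
  simp only [TangentPairing.christoffel, key]

/-- The geodesic equation in a global chart. -/
theorem isGeodesicOn_iff [IsManifold 𝓘(ℝ, E) ∞ M] {γ : ℝ → M} {J : Set ℝ} :
    IsGeodesicOn g γ J ↔ ContDiffOn ℝ ∞ (c ∘ γ) J ∧ ∀ t ∈ J, ∀ w : E,
      B (c (γ t)) (deriv (deriv (c ∘ γ)) t) w
        + (1 / 2) * (2 * fderiv ℝ (fun z => B z (deriv (c ∘ γ) t) w) (c (γ t)) (deriv (c ∘ γ) t)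
          - fderiv ℝ (fun z => B z (deriv (c ∘ γ) t) (deriv (c ∘ γ) t)) (c (γ t)) w) = 0 := by
  have h1 : ContMDiffOn 𝓘(ℝ, ℝ) 𝓘(ℝ, E) ∞ γ J ↔ ContDiffOn ℝ ∞ (c ∘ γ) J :=
    hc.contMDiffOn_iff (n := ⊤)
  have h2 : ∀ t, (fun s => extChartAt 𝓘(ℝ, E) (γ t) (γ s)) = c ∘ γ := fun t =>
    funext fun s => hc.extChartAt_apply _ _
  have h3 : ∀ t w,
      g.inChart (γ t) (extChartAt 𝓘(ℝ, E) (γ t) (γ t))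
        (deriv (deriv fun s => extChartAt 𝓘(ℝ, E) (γ t) (γ s)) t) w
      + g.christoffel (γ t) (extChartAt 𝓘(ℝ, E) (γ t) (γ t))
        (deriv (fun s => extChartAt 𝓘(ℝ, E) (γ t) (γ s)) t)
        (deriv (fun s => extChartAt 𝓘(ℝ, E) (γ t) (γ s)) t) w =
      B (c (γ t)) (deriv (deriv (c ∘ γ)) t) w
        + (1 / 2) * (2 * fderiv ℝ (fun z => B z (deriv (c ∘ γ) t) w) (c (γ t)) (deriv (c ∘ γ) t)
          - fderiv ℝ (fun z => B z (deriv (c ∘ γ) t) (deriv (c ∘ γ) t)) (c (γ t)) w) := by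
    intro t w
    rw [h2, hc.extChartAt_apply, hc.inChart_eq_of_eq hB _ (mem_range_self _),
      hc.christoffel_eq_of_eq hB _ (mem_range_self _)]
    ring
  constructor
  · intro h
    exact ⟨h1.1 h.1, fun t ht w => (h3 t w).symm.trans (h.2 t ht w)⟩
  · intro h
    exact ⟨h1.2 h.1, fun t ht w => (h3 t w).trans (h.2 t ht w)⟩

theorem curveLength_eq [IsManifold 𝓘(ℝ, E) ∞ M] {γ : ℝ → M}
    (hγ : ContMDiffOn 𝓘(ℝ, ℝ) 𝓘(ℝ, E) 2 γ (Icc 0 1)) :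
    curveLength g γ =
      ∫ t in Ioo (0 : ℝ) 1, √(B (c (γ t)) (deriv (c ∘ γ) t) (deriv (c ∘ γ) t)) := by
  have h2 : ContDiffOn ℝ 2 (c ∘ γ) (Icc 0 1) := (hc.contMDiffOn_iff (n := 2)).1 hγ
  rw [curveLength, intervalIntegral.integral_of_le zero_le_one,
    MeasureTheory.integral_Ioc_eq_integral_Ioo]
  refine MeasureTheory.setIntegral_congr_fun measurableSet_Ioo fun t ht => ?_
  have hn : Icc (0 : ℝ) 1 ∈ 𝓝 t := Icc_mem_nhds ht.1 ht.2
  simp only [hB]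
  rw [hc.mfderiv_curve (hγ.continuousOn.continuousAt hn)
    ((h2.contDiffAt hn).differentiableAt (by norm_num))]

end IsGlobalChart

end GlobalChartMetric

/-! ### Totally geodesic linear slices -/

section Slice

set_option synthInstance.maxHeartbeats 200000

variable {V : Type*} [NormedAddCommGroup V] [NormedSpace ℝ V]
  {F : Type*} [NormedAddCommGroup F] [NormedSpace ℝ F]

theorem two_le_infty : ((2 : ℕ∞) : WithTop ℕ∞) ≤ ∞ := by exact_mod_cast le_top

theorem hasFDerivAt_bilinear_apply {X : Type*} [NormedAddCommGroup X] [NormedSpace ℝ X]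
    {f : X → V →L[ℝ] V →L[ℝ] ℝ} {f' : X →L[ℝ] V →L[ℝ] V →L[ℝ] ℝ} {x : X}
    (hf : HasFDerivAt f f' x) (v w : V) :
    HasFDerivAt (fun z => f z v w) ((f'.flip v).flip w) x := by
  have h1 : HasFDerivAt (fun z => f z v) (f'.flip v) x := by
    simpa using hf.clm_apply (hasFDerivAt_const v x)
  simpa using h1.clm_apply (hasFDerivAt_const w x)

namespace IsLinearSlice

variable {U : TopologicalSpace.Opens V} {S : Set U} {ι : F →L[ℝ] V} {p : V →L[ℝ] F}
  (h : IsLinearSlice U S ι p) {g : TangentPairing V U} {b : V → V →L[ℝ] V →L[ℝ] ℝ}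

include h

/-- In the coordinate `p` the induced metric of the slice is `b` restricted to the range of `ι`. -/
theorem pullback_eq [Nonempty S] (hb : ∀ (x : U) v w, g x v w = b x v w) :
    letI := h.chartedSpace
    ∀ (x : S) (v w : F), g.pullback (F := F) (Subtype.val : S → U) x v w =
      b (ι (p ((x : U) : V))) (ι v) (ι w) := by
  let := h.chartedSpace
  intro x v w
  have hd := h.isGlobalChart.hasMFDerivAt_of_linear (f := (Subtype.val : S → U))
    (isGlobalChart_opens U) continuous_subtype_val (L := ι) (fun x => (h.apply_coord x).symm) x
  unfold TangentPairing.pullback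
  rw [hd.mfderiv, hb, h.apply_coord]
  rfl

/-- Suppose every vector splits into a part tangent to the slice and a part `k` that is orthogonal
to the slice and along which the lengths of the vectors tangent to the slice are stationary. Then
the geodesics of the slice are geodesics of the ambient manifold: the geodesic equation tested with
a tangent vector is the geodesic equation of the slice, and tested with `k` it is trivial. -/
theorem isGeodesicOn_of_orthogonal [Nonempty S] (hb : ∀ (x : U) v w, g x v w = b x v w)
    (hbd : DifferentiableOn ℝ b U)
    (hk : ∀ w : V, ∃ u k, w = ι u + k ∧ ∀ y a, ι y ∈ U →
      b (ι y) (ι a) k = 0 ∧ fderiv ℝ b (ι y) k (ι a) (ι a) = 0)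
    {J : Set ℝ} (hJ : IsOpen J) {γ : ℝ → S} :
    letI := h.chartedSpace
    IsGeodesicOn (g.pullback (F := F) (Subtype.val : S → U)) γ J →
      IsGeodesicOn g (fun t => (γ t : U)) J := by
  let := h.chartedSpace
  have := h.isManifold
  intro hγ
  rw [h.isGlobalChart.isGeodesicOn_iff (B := fun y v w => b (ι y) (ι v) (ι w))
    (h.pullback_eq hb)] at hγ
  rw [(isGlobalChart_opens U).isGeodesicOn_iff (B := fun y v w => b y v w) hb]
  set c : ℝ → F := (fun x : S => p ((x : U) : V)) ∘ γ with hc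
  have hC : (Subtype.val : U → V) ∘ (fun t => (γ t : U)) = ι ∘ c :=
    funext fun t => (h.apply_coord (γ t)).symm
  obtain ⟨hs, heq⟩ := hγ
  rw [hC]
  refine ⟨ι.contDiff.comp_contDiffOn hs, fun t ht w => ?_⟩
  have hd1 : ∀ s ∈ J, deriv (ι ∘ c) s = ι (deriv c s) := fun s hs' =>
    (ι.hasFDerivAt.comp_hasDerivAt s ((hs.contDiffAt (hJ.mem_nhds hs')).differentiableAt
      (by simp)).hasDerivAt).deriv
  have hd2 : deriv (deriv (ι ∘ c)) t = ι (deriv (deriv c) t) := by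
    have hev : deriv (ι ∘ c) =ᶠ[𝓝 t] ι ∘ deriv c := by
      filter_upwards [hJ.mem_nhds ht] with s hs'
      exact hd1 s hs'
    rw [hev.deriv_eq]
    have hcd : DifferentiableAt ℝ (deriv c) t := by
      have h2 : ContDiffOn ℝ ∞ (deriv c) J := ((contDiffOn_infty_iff_deriv_of_isOpen hJ).1 hs).2
      exact (h2.contDiffAt (hJ.mem_nhds ht)).differentiableAt (by simp)
    exact (ι.hasFDerivAt.comp_hasDerivAt t hcd.hasDerivAt).deriv
  have hCt : ((γ t : U) : V) = ι (c t) := (h.apply_coord (γ t)).symm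
  have hU : ι (c t) ∈ U := hCt ▸ (γ t : U).2
  rw [hd1 t ht, hd2, hCt]
  have hbt : DifferentiableAt ℝ b (ι (c t)) := (hbd _ hU).differentiableAt (U.isOpen.mem_nhds hU)
  have e1 : ∀ u v w : V, fderiv ℝ (fun z => b z v w) (ι (c t)) u = fderiv ℝ b (ι (c t)) u v w := by
    intro u v w
    rw [(hasFDerivAt_bilinear_apply hbt.hasFDerivAt v w).fderiv]
    rfl
  have e2 : ∀ (u : F) (v w : V), fderiv ℝ (fun z => b (ι z) v w) (c t) u =
      fderiv ℝ b (ι (c t)) (ι u) v w := by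
    intro u v w
    change fderiv ℝ ((fun z => b z v w) ∘ ι) (c t) u = _
    rw [((hasFDerivAt_bilinear_apply hbt.hasFDerivAt v w).comp (c t) ι.hasFDerivAt).fderiv]
    rfl
  obtain ⟨u, k, rfl, hk⟩ := hk w
  have hku := heq t ht u
  change b (ι (c t)) _ _ + (1 / 2) * (2 * fderiv ℝ _ (c t) _ - fderiv ℝ _ (c t) _) = 0 at hku
  rw [e2, e2] at hku
  rw [e1, e1]
  -- The slice is `g`-orthogonal to `k`, so the derivative of `g (·, k)` along it vanishes.
  have hk1 : fderiv ℝ b (ι (c t)) (ι (deriv c t)) (ι (deriv c t)) k = 0 := by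
    rw [← e2]
    have hev : (fun z => b (ι z) (ι (deriv c t)) k) =ᶠ[𝓝 (c t)] fun _ => 0 := by
      filter_upwards [(U.isOpen.preimage ι.continuous).mem_nhds hU] with z hz
      exact (hk z _ hz).1
    rw [hev.fderiv_eq, fderiv_const_apply]
    rfl
  simp only [map_add, add_apply, (hk _ _ hU).1, (hk _ _ hU).2, hk1]
  linarith

/-- A retraction `ρ` of `U` onto the slice that does not increase the lengths of tangent vectors
does not increase the lengths of curves, so a shortest curve of the slice is shortest in `U`. -/
theorem isMinimizingGeodesic_of_retraction [Nonempty S] (hb : ∀ (x : U) v w, g x v w = b x v w)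
    (hbc : ContinuousOn b U) {ρ : V → F} (hρ : ContDiffOn ℝ 2 ρ U) (hρU : ∀ x ∈ U, ι (ρ x) ∈ U)
    (hfix : ∀ x : S, ρ ((x : U) : V) = p ((x : U) : V))
    (hle : ∀ x ∈ U, ∀ a, b (ι (ρ x)) (ι (fderiv ℝ ρ x a)) (ι (fderiv ℝ ρ x a)) ≤ b x a a)
    {γ : ℝ → S} :
    letI := h.chartedSpace
    IsMinimizingGeodesic (g.pullback (F := F) (Subtype.val : S → U)) γ →
      IsMinimizingGeodesic g (fun t => (γ t : U)) := by
  let := h.chartedSpace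
  have := h.isManifold
  intro hγ
  have hUc := isGlobalChart_opens U
  have hSc := h.isGlobalChart
  have hCγ : ContMDiffOn 𝓘(ℝ, ℝ) 𝓘(ℝ, V) 2 (fun t => (γ t : U)) (Icc 0 1) :=
    (h.isSmoothEmbedding.contMDiff.of_le two_le_infty).comp_contMDiffOn hγ.1
  refine ⟨hCγ, fun σ hσ h0 h1 => ?_⟩
  -- The length of a curve of the slice, measured in the slice, is its length in `U`.
  have hlen : ∀ τ : ℝ → S, ContMDiffOn 𝓘(ℝ, ℝ) 𝓘(ℝ, F) 2 τ (Icc 0 1) →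
      curveLength (g.pullback (F := F) (Subtype.val : S → U)) τ =
        curveLength g (fun t => (τ t : U)) := by
    intro τ hτ
    have hτU : ContMDiffOn 𝓘(ℝ, ℝ) 𝓘(ℝ, V) 2 (fun t => (τ t : U)) (Icc 0 1) :=
      (h.isSmoothEmbedding.contMDiff.of_le two_le_infty).comp_contMDiffOn hτ
    rw [hSc.curveLength_eq (B := fun y v w => b (ι y) (ι v) (ι w)) (h.pullback_eq hb) hτ,
      hUc.curveLength_eq (B := fun y v w => b y v w) hb hτU]
    refine MeasureTheory.setIntegral_congr_fun measurableSet_Ioo fun t ht => ?_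
    have hn : Icc (0 : ℝ) 1 ∈ 𝓝 t := Icc_mem_nhds ht.1 ht.2
    have hd := ((((hSc.contMDiffOn_iff (n := 2)).1 hτ).contDiffAt hn).differentiableAt
      (by norm_num)).hasDerivAt
    have hC : (Subtype.val : U → V) ∘ (fun t => (τ t : U)) =
        ι ∘ ((fun x : S => p ((x : U) : V)) ∘ τ) := funext fun t => (h.apply_coord (τ t)).symm
    have hd' := (ι.hasFDerivAt.comp_hasDerivAt t hd).deriv
    simp only [hC, hd', h.apply_coord]
  have hρS : ∀ t, (⟨ι (ρ (σ t)), hρU _ (σ t).2⟩ : U) ∈ S := fun t =>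
    (h.mem_iff _).2 (by simp [h.leftInverse])
  -- The competitor in the slice is the retraction of `σ`.
  let τ : ℝ → S := fun t => ⟨⟨ι (ρ (σ t)), hρU _ (σ t).2⟩, hρS t⟩
  have hσ' : ContDiffOn ℝ 2 ((Subtype.val : U → V) ∘ σ) (Icc 0 1) :=
    (hUc.contMDiffOn_iff (n := 2)).1 hσ
  have hcτ : ((fun x : S => p ((x : U) : V)) ∘ τ) = ρ ∘ ((Subtype.val : U → V) ∘ σ) :=
    funext fun t => h.leftInverse _
  have hτ : ContMDiffOn 𝓘(ℝ, ℝ) 𝓘(ℝ, F) 2 τ (Icc 0 1) := by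
    refine (hSc.contMDiffOn_iff (n := 2)).2 ?_
    rw [hcτ]
    exact hρ.comp hσ' fun t _ => (σ t).2
  have hend : ∀ t, σ t = (γ t : U) → τ t = γ t := by
    intro t ht
    apply Subtype.ext
    apply Subtype.ext
    change ι (ρ (σ t)) = _
    rw [ht, hfix, h.apply_coord]
  rw [← hlen γ hγ.1]
  refine (hγ.2 τ hτ (hend 0 h0) (hend 1 h1)).trans ?_
  rw [hSc.curveLength_eq (B := fun y v w => b (ι y) (ι v) (ι w)) (h.pullback_eq hb) hτ,
    hUc.curveLength_eq (B := fun y v w => b y v w) hb hσ]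
  refine MeasureTheory.integral_mono_of_nonneg
    (Filter.Eventually.of_forall fun t => Real.sqrt_nonneg _) ?_ ?_
  · -- The speed agrees on `(0, 1)` with the one-sided speed, which is continuous on `[0, 1]`.
    set C : ℝ → V := (Subtype.val : U → V) ∘ σ with hC
    have hcont : ContinuousOn (fun t => √(b (C t) (derivWithin C (Icc 0 1) t)
        (derivWithin C (Icc 0 1) t))) (Icc 0 1) := by
      have hd : ContinuousOn (derivWithin C (Icc 0 1)) (Icc 0 1) :=
        hσ'.continuousOn_derivWithin (uniqueDiffOn_Icc zero_lt_one) (by norm_num)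
      have hbC : ContinuousOn (fun t => b (C t)) (Icc 0 1) :=
        hbc.comp hσ'.continuousOn fun t _ => (σ t).2
      exact ((hbC.clm_apply hd).clm_apply hd).sqrt
    have hint : MeasureTheory.IntegrableOn (fun t => √(b (C t) (derivWithin C (Icc 0 1) t)
        (derivWithin C (Icc 0 1) t))) (Ioo 0 1) :=
      (hcont.integrableOn_Icc).mono_set Ioo_subset_Icc_self
    refine hint.congr_fun (fun t ht => ?_) measurableSet_Ioo
    simp only [derivWithin_of_mem_nhds (Icc_mem_nhds ht.1 ht.2)]
    rfl
  · refine (MeasureTheory.ae_restrict_iff' measurableSet_Ioo).2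
      (Filter.Eventually.of_forall fun t ht => ?_)
    have hn : Icc (0 : ℝ) 1 ∈ 𝓝 t := Icc_mem_nhds ht.1 ht.2
    have hd := ((hσ'.contDiffAt hn).differentiableAt (by norm_num)).hasDerivAt
    have hρd : HasFDerivAt ρ (fderiv ℝ ρ (σ t)) (σ t) :=
      ((hρ.contDiffAt (U.isOpen.mem_nhds (σ t).2)).differentiableAt (by norm_num)).hasFDerivAt
    have hd' := (hρd.comp_hasDerivAt t hd).deriv
    simp only [hcτ]
    refine Real.sqrt_le_sqrt ?_
    rw [hd']
    have hpt : p (((τ t : S) : U) : V) = ρ (σ t) := h.leftInverse _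
    rw [hpt]
    exact hle _ (σ t).2 _

end IsLinearSlice

/-- A slice that has a length-nonincreasing retraction, and a complement as in
`IsLinearSlice.isGeodesicOn_of_orthogonal`, is totally geodesic in both senses. -/
theorem IsLinearSlice.isTotallyGeodesic {F : Type} [NormedAddCommGroup F] [NormedSpace ℝ F]
    [FiniteDimensional ℝ F] {U : TopologicalSpace.Opens V} {S : Set U} [Nonempty S]
    {ι : F →L[ℝ] V} {p : V →L[ℝ] F} (h : IsLinearSlice U S ι p)
    (g : ContMDiffRiemannianMetric 𝓘(ℝ, V) ∞ V (fun x : U => TangentSpace 𝓘(ℝ, V) x))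
    {b : V → V →L[ℝ] V →L[ℝ] ℝ} (hb : ∀ (x : U) (v w : V), g.inner x v w = b x v w)
    (hbd : DifferentiableOn ℝ b U)
    (hk : ∀ w : V, ∃ u k, w = ι u + k ∧ ∀ y a, ι y ∈ U →
      b (ι y) (ι a) k = 0 ∧ fderiv ℝ b (ι y) k (ι a) (ι a) = 0)
    {ρ : V → F} (hρ : ContDiffOn ℝ 2 ρ U) (hρU : ∀ x ∈ U, ι (ρ x) ∈ U)
    (hfix : ∀ x : S, ρ ((x : U) : V) = p ((x : U) : V))
    (hle : ∀ x ∈ U, ∀ a, b (ι (ρ x)) (ι (fderiv ℝ ρ x a)) (ι (fderiv ℝ ρ x a)) ≤ b x a a) :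
    IsTotallyGeodesicSubmanifold g S ∧ IsTotallyGeodesicForMinimizers g S :=
  ⟨⟨F, _, _, inferInstance, h.chartedSpace, h.isManifold, h.isSmoothEmbedding,
    fun _ _ hJ _ => h.isGeodesicOn_of_orthogonal hb hbd hk hJ⟩,
  ⟨F, _, _, inferInstance, h.chartedSpace, h.isManifold, h.isSmoothEmbedding,
    fun _ => h.isMinimizingGeodesic_of_retraction hb hbd.continuousOn hρ hρU hfix hle⟩⟩

end Slice

/-! ### Congruence transformations and the metric -/

section Congruence

open Matrix

theorem hasDerivAt_det_one_add_smul {m : Type*} [Fintype m] [DecidableEq m]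
    (S : Matrix m m ℝ) : HasDerivAt (fun t : ℝ => (1 + t • S).det) S.trace 0 := by
  have h : (fun t : ℝ => (1 + t • S).det) = fun t : ℝ => 1 + S.trace * t +
      Polynomial.eval t (1 + (Polynomial.X : Polynomial ℝ) • S.map Polynomial.C).det.divX.divX
        * t ^ 2 := funext fun t => det_one_add_smul t S
  rw [h]
  have h1 := (((hasDerivAt_id (0 : ℝ)).const_mul S.trace).const_add 1).add
    ((Polynomial.hasDerivAt
      (1 + (Polynomial.X : Polynomial ℝ) • S.map Polynomial.C).det.divX.divX 0).mul
      ((hasDerivAt_id (0 : ℝ)).pow 2))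
  refine (h1.congr_deriv ?_)
  simp

/-- The transformation `(X, A) ↦ (T⁻¹ X T⁻ᵀ, T⁻¹ A T⁻ᵀ)` brings the base point to the identity. -/
theorem betaForm_self_of_congruence {n : ℕ} (β : ℝ) {X T S : Matrix (Fin n) (Fin n) ℝ}
    (hT : IsUnit T.det) (hX : X = T * Tᵀ) {A : SymMat n} (hA : A.toMatrix = T * S * Tᵀ) :
    betaForm n β X A A = X.det ^ β * (∑ i, ∑ j, S i j ^ 2 - β * S.trace ^ 2) := by
  have hTt : IsUnit Tᵀ.det := by rwa [det_transpose]
  have hS : Sᵀ = S := by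
    have h1 : S = T⁻¹ * A.toMatrix * Tᵀ⁻¹ := by
      rw [hA, Matrix.mul_assoc, Matrix.mul_nonsing_inv_cancel_right _ _ hTt,
        Matrix.nonsing_inv_mul_cancel_left _ _ hT]
    rw [h1]
    simp [Matrix.transpose_mul, Matrix.transpose_nonsing_inv, (SymMat.toMatrix_isSymm A).eq,
      Matrix.mul_assoc]
  have h1 : X⁻¹ * A.toMatrix = Tᵀ⁻¹ * (S * Tᵀ) := by
    rw [hX, hA, Matrix.mul_inv_rev, Matrix.mul_assoc, Matrix.mul_assoc T,
      Matrix.nonsing_inv_mul_cancel_left _ _ hT]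
  have h2 : (X⁻¹ * A.toMatrix).trace = S.trace := by
    rw [h1, trace_mul_comm, Matrix.mul_nonsing_inv_cancel_right _ _ hTt]
  have h3 : (X⁻¹ * A.toMatrix * X⁻¹ * A.toMatrix).trace = ∑ i, ∑ j, S i j ^ 2 := by
    rw [Matrix.mul_assoc (X⁻¹ * A.toMatrix), h1, trace_mul_comm, Matrix.mul_assoc,
      Matrix.mul_assoc, Matrix.mul_nonsing_inv_cancel_left _ _ hTt, trace_mul_comm,
      Matrix.mul_assoc, Matrix.mul_assoc, Matrix.mul_nonsing_inv _ hTt, Matrix.mul_one]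
    simp only [Matrix.trace, Matrix.diag, Matrix.mul_apply]
    refine Finset.sum_congr rfl fun i _ => Finset.sum_congr rfl fun j _ => ?_
    rw [show S j i = S i j from congrFun (congrFun hS i) j]
    ring
  simp only [betaForm, LinearMap.mk₂_apply, h2, h3]
  ring

theorem exists_congruence {n : ℕ} {T : Matrix (Fin n) (Fin n) ℝ} (hT : IsUnit T.det)
    (A : Matrix (Fin n) (Fin n) ℝ) : ∃ S, A = T * S * Tᵀ := by
  have hTt : IsUnit Tᵀ.det := by rwa [det_transpose]
  refine ⟨T⁻¹ * A * Tᵀ⁻¹, ?_⟩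
  rw [Matrix.mul_assoc T, Matrix.nonsing_inv_mul_cancel_right _ _ hTt,
    Matrix.mul_nonsing_inv_cancel_left _ _ hT]

/-! ### Cholesky decomposition and leading minors -/

/-- **Cholesky decomposition**. -/
theorem exists_cholesky {n : ℕ} {X : Matrix (Fin n) (Fin n) ℝ} (hX : X.PosDef) :
    ∃ T : Matrix (Fin n) (Fin n) ℝ, T.IsLowerTriangular ∧ IsUnit T.det ∧ X = T * Tᵀ := by
  have hLt : (LDL.lowerInv hX).IsLowerTriangular := fun i j hij => LDL.lowerInv_triangular hX hij
  have hlow : (LDL.lower hX).IsLowerTriangular := blockTriangular_inv_of_blockTriangular hLt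
  have hdiag : ∀ i, 0 ≤ LDL.diagEntries hX i := by
    intro i
    have h : (LDL.diag hX).PosSemidef := by
      rw [LDL.diag_eq_lowerInv_conj]
      exact hX.posSemidef.mul_mul_conjTranspose_same _
    simpa [LDL.diag] using h.diag_nonneg (i := i)
  set T := LDL.lower hX * diagonal fun i => √(LDL.diagEntries hX i) with hT
  have hXT : X = T * Tᵀ := by
    have h := LDL.lower_conj_diag hX
    have hd : LDL.diag hX = (diagonal fun i => √(LDL.diagEntries hX i)) *
        diagonal fun i => √(LDL.diagEntries hX i) := by
      rw [diagonal_mul_diagonal, LDL.diag]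
      congr 1
      ext i
      exact (Real.mul_self_sqrt (hdiag i)).symm
    rw [hT, transpose_mul, diagonal_transpose]
    conv_lhs => rw [← h, hd]
    simp only [Matrix.mul_assoc, conjTranspose_eq_transpose_of_trivial]
  refine ⟨T, hlow.mul (blockTriangular_diagonal _), ?_, hXT⟩
  have hdet := hX.det_pos
  rw [hXT, det_mul, det_transpose] at hdet
  exact isUnit_iff_ne_zero.2 fun h0 => by simp [h0] at hdet

/-- The upper left `k × k` block. -/
def leadingBlock {n : ℕ} (k : ℕ) (hk : k ≤ n) (X : Matrix (Fin n) (Fin n) ℝ) :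
    Matrix (Fin k) (Fin k) ℝ :=
  X.submatrix (Fin.castLE hk) (Fin.castLE hk)

/-- Left multiplication by a lower triangular matrix is compatible with leading blocks, because the
first `k` rows of that matrix vanish beyond column `k`. -/
theorem leadingBlock_lower_mul {n k : ℕ} (hk : k ≤ n) {T : Matrix (Fin n) (Fin n) ℝ}
    (hT : T.IsLowerTriangular) (B : Matrix (Fin n) (Fin n) ℝ) :
    leadingBlock k hk (T * B) = leadingBlock k hk T * leadingBlock k hk B := by
  ext i j
  simp only [leadingBlock, submatrix_apply, mul_apply]
  refine (Fintype.sum_of_injective (Fin.castLE hk) (Fin.castLE_injective hk) _ _ ?_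
    fun _ => rfl).symm
  intro l hl
  have hkl : k ≤ l := by
    by_contra! h
    exact hl ⟨⟨l, h⟩, rfl⟩
  have : T (Fin.castLE hk i) l = 0 := hT (show Fin.castLE hk i < l from
    Fin.lt_def.2 (lt_of_lt_of_le i.2 hkl))
  rw [this, zero_mul]

theorem leadingBlock_transpose {n k : ℕ} (hk : k ≤ n) (B : Matrix (Fin n) (Fin n) ℝ) :
    leadingBlock k hk Bᵀ = (leadingBlock k hk B)ᵀ := rfl

theorem leadingBlock_lower_conj {n k : ℕ} (hk : k ≤ n) {T : Matrix (Fin n) (Fin n) ℝ}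
    (hT : T.IsLowerTriangular) (S : Matrix (Fin n) (Fin n) ℝ) :
    leadingBlock k hk (T * S * Tᵀ) =
      leadingBlock k hk T * leadingBlock k hk S * (leadingBlock k hk T)ᵀ := by
  have h : leadingBlock k hk (S * Tᵀ) = leadingBlock k hk S * (leadingBlock k hk T)ᵀ := by
    have := congrArg transpose (leadingBlock_lower_mul hk hT Sᵀ)
    rwa [← leadingBlock_transpose, transpose_mul, transpose_transpose, transpose_mul,
      leadingBlock_transpose, transpose_transpose] at this
  rw [Matrix.mul_assoc, leadingBlock_lower_mul hk hT, h, Matrix.mul_assoc]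

theorem det_leadingBlock_of_lower {n k : ℕ} (hk : k ≤ n) {T : Matrix (Fin n) (Fin n) ℝ}
    (hT : T.IsLowerTriangular) :
    (leadingBlock k hk T).det = ∏ j : Fin k, T (Fin.castLE hk j) (Fin.castLE hk j) :=
  det_of_isLowerTriangular _ fun _ _ hij => hT hij

/-- The determinants of the leading blocks along the line through `X = T Tᵀ` in the direction
`A = T S Tᵀ`. -/
theorem det_leadingBlock_line {n k : ℕ} (hk : k ≤ n) {T : Matrix (Fin n) (Fin n) ℝ}
    (hT : T.IsLowerTriangular) (S : Matrix (Fin n) (Fin n) ℝ) (t : ℝ) :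
    (leadingBlock k hk (T * Tᵀ + t • (T * S * Tᵀ))).det =
      (∏ j : Fin k, T (Fin.castLE hk j) (Fin.castLE hk j)) ^ 2 *
        (1 + t • leadingBlock k hk S).det := by
  have h1 : T * Tᵀ + t • (T * S * Tᵀ) = T * (1 + t • S) * Tᵀ := by
    simp [Matrix.mul_add, Matrix.add_mul]
  have h2 : leadingBlock k hk (1 + t • S) = 1 + t • leadingBlock k hk S := by
    simp only [leadingBlock, submatrix_add, submatrix_smul, Pi.add_apply, Pi.smul_apply,
      submatrix_one _ (Fin.castLE_injective hk)]
  rw [h1, leadingBlock_lower_conj hk hT, h2, det_mul, det_mul, det_transpose,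
    det_leadingBlock_of_lower hk hT]
  ring

/-- The quotients of consecutive leading minors: the squares of the diagonal entries of the lower
triangular Cholesky factor. -/
noncomputable def choleskyDiag {n : ℕ} (X : SymMat n) (i : Fin n) : ℝ :=
  (leadingBlock (i + 1) i.2 X.toMatrix).det / (leadingBlock i i.2.le X.toMatrix).det

theorem diag_ne_zero_of_lower {n : ℕ} {T : Matrix (Fin n) (Fin n) ℝ} (hT : T.IsLowerTriangular)
    (hu : IsUnit T.det) (i : Fin n) : T i i ≠ 0 := by
  rw [det_of_isLowerTriangular _ hT, isUnit_iff_ne_zero] at hu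
  exact Finset.prod_ne_zero_iff.1 hu i (Finset.mem_univ i)

theorem choleskyDiag_line {n : ℕ} {X A : SymMat n} {T S : Matrix (Fin n) (Fin n) ℝ}
    (hT : T.IsLowerTriangular) (hu : IsUnit T.det) (hX : X.toMatrix = T * Tᵀ)
    (hA : A.toMatrix = T * S * Tᵀ) (i : Fin n) (t : ℝ) :
    choleskyDiag (X + t • A) i = T i i ^ 2 *
      ((1 + t • leadingBlock (i + 1) i.2 S).det / (1 + t • leadingBlock i i.2.le S).det) := by
  simp only [choleskyDiag, map_add, map_smul, hX, hA]
  rw [det_leadingBlock_line _ hT, det_leadingBlock_line _ hT, Fin.prod_univ_castSucc]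
  simp only [Fin.castLE_castSucc]
  have h0 : ∏ j : Fin i, T (Fin.castLE i.2.le j) (Fin.castLE i.2.le j) ≠ 0 :=
    Finset.prod_ne_zero_iff.2 fun j _ => diag_ne_zero_of_lower hT hu _
  have hi : Fin.castLE i.2 (Fin.last i) = i := rfl
  rw [hi, mul_pow, mul_assoc, mul_div_mul_left _ _ (pow_ne_zero 2 h0), mul_div_assoc]

theorem choleskyDiag_eq {n : ℕ} {X : SymMat n} {T : Matrix (Fin n) (Fin n) ℝ}
    (hT : T.IsLowerTriangular) (hu : IsUnit T.det) (hX : X.toMatrix = T * Tᵀ) (i : Fin n) :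
    choleskyDiag X i = T i i ^ 2 := by
  simpa using choleskyDiag_line (A := 0) (S := 0) hT hu hX (by simp) i 0

/-- The logarithmic derivative of `T_ii²` is `S_ii`, as `S_ii` is the difference of the traces of two
consecutive leading blocks of `S`. -/
theorem hasDerivAt_choleskyDiag_line {n : ℕ} {X A : SymMat n} {T S : Matrix (Fin n) (Fin n) ℝ}
    (hT : T.IsLowerTriangular) (hu : IsUnit T.det) (hX : X.toMatrix = T * Tᵀ)
    (hA : A.toMatrix = T * S * Tᵀ) (i : Fin n) :
    HasDerivAt (fun t : ℝ => choleskyDiag (X + t • A) i) (T i i ^ 2 * S i i) 0 := by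
  simp only [choleskyDiag_line hT hu hX hA]
  have h := ((hasDerivAt_det_one_add_smul (leadingBlock (i + 1) i.2 S)).div
    (hasDerivAt_det_one_add_smul (leadingBlock i i.2.le S)) (by simp)).const_mul (T i i ^ 2)
  refine h.congr_deriv ?_
  have htr : (leadingBlock (i + 1) i.2 S).trace = (leadingBlock i i.2.le S).trace + S i i := by
    simp only [Matrix.trace, Fin.sum_univ_castSucc]
    rfl
  simp [htr]

theorem contDiffOn_choleskyDiag (n : ℕ) :
    ContDiffOn ℝ ∞ (choleskyDiag (n := n)) (PosDefCone n) := by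
  refine contDiffOn_pi.2 fun i => ?_
  have hb : ∀ k (hk : k ≤ n), ContDiffOn ℝ ∞
      (fun X : SymMat n => (leadingBlock k hk X.toMatrix).det) (PosDefCone n) := fun k hk =>
    contDiffOn_det fun a b => (SymMat.contDiff_entry _ _).contDiffOn
  refine (hb _ _).div (hb _ _) fun X hX => ?_
  obtain ⟨T, hT, hu, hXT⟩ := exists_cholesky hX
  have h := det_leadingBlock_line i.2.le hT 0 0
  rw [← hXT] at h
  simp only [zero_smul, add_zero, det_one, mul_one] at h
  rw [h]
  exact pow_ne_zero 2 (Finset.prod_ne_zero_iff.2 fun j _ => diag_ne_zero_of_lower hT hu _)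

/-- The directional derivative of a differentiable map is the derivative along the line. -/
theorem fderiv_eq_of_hasDerivAt_line {E F : Type*} [NormedAddCommGroup E] [NormedSpace ℝ E]
    [NormedAddCommGroup F] [NormedSpace ℝ F] {f : E → F} {x a : E} {f' : F}
    (hf : DifferentiableAt ℝ f x) (h : HasDerivAt (fun t : ℝ => f (x + t • a)) f' 0) :
    fderiv ℝ f x a = f' := by
  rw [← hf.lineDeriv_eq_fderiv]
  exact h.deriv

end Congruence

/-! ### Derivatives of the metric -/

section Derivative

open Matrix

-- Any norm that makes the matrices a normed algebra serves to differentiate products and inverses.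
attribute [local instance] Matrix.linftyOpNormedRing Matrix.linftyOpNormedAlgebra

theorem hasDerivAt_inv_line {n : ℕ} {X : Matrix (Fin n) (Fin n) ℝ} (hX : IsUnit X)
    (W : Matrix (Fin n) (Fin n) ℝ) :
    HasDerivAt (fun t : ℝ => (X + t • W)⁻¹) (-(X⁻¹ * W * X⁻¹)) 0 := by
  obtain ⟨u, rfl⟩ := hX
  have hline : HasDerivAt (fun t : ℝ => (u : Matrix (Fin n) (Fin n) ℝ) + t • W) W 0 := by
    have h := ((hasDerivAt_id (0 : ℝ)).smul_const W).const_add (u : Matrix (Fin n) (Fin n) ℝ)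
    rw [one_smul] at h
    exact h
  have hinv := hasFDerivAt_ringInverse (𝕜 := ℝ) u
  rw [show (u : Matrix (Fin n) (Fin n) ℝ) = (u : Matrix (Fin n) (Fin n) ℝ) + (0 : ℝ) • W by simp]
    at hinv
  have h := HasFDerivAt.comp_hasDerivAt (0 : ℝ) hinv hline
  simp only [nonsing_inv_eq_ringInverse, Ring.inverse_unit]
  refine h.congr_deriv ?_
  simp

theorem hasDerivAt_trace {n : ℕ} {f : ℝ → Matrix (Fin n) (Fin n) ℝ}
    {f' : Matrix (Fin n) (Fin n) ℝ} {t : ℝ} (hf : HasDerivAt f f' t) :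
    HasDerivAt (fun s => (f s).trace) f'.trace t :=
  (LinearMap.toContinuousLinearMap
    (traceLinearMap (Fin n) ℝ ℝ)).hasFDerivAt.comp_hasDerivAt t hf

theorem hasDerivAt_det_line {n : ℕ} {X : Matrix (Fin n) (Fin n) ℝ} (hX : IsUnit X.det)
    (W : Matrix (Fin n) (Fin n) ℝ) :
    HasDerivAt (fun t : ℝ => (X + t • W).det) (X.det * (X⁻¹ * W).trace) 0 := by
  have h : ∀ t : ℝ, (X + t • W).det = X.det * (1 + t • (X⁻¹ * W)).det := fun t => by
    rw [← det_mul, Matrix.mul_add, Matrix.mul_one, Matrix.mul_smul,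
      Matrix.mul_nonsing_inv_cancel_left _ _ hX]
  simp only [h]
  exact (hasDerivAt_det_one_add_smul (X⁻¹ * W)).const_mul _

/-- The length of `A` is stationary at `X` in the direction `W` if the variations of `log det X`,
`trace (X⁻¹ A)` and `trace (X⁻¹ A X⁻¹ A)` vanish. -/
theorem hasDerivAt_betaForm_line {n : ℕ} (β : ℝ) {X : SymMat n} (hX : X.toMatrix.PosDef)
    {W A : SymMat n} (h1 : (X.toMatrix⁻¹ * W.toMatrix).trace = 0)
    (h2 : (X.toMatrix⁻¹ * W.toMatrix * X.toMatrix⁻¹ * A.toMatrix).trace = 0)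
    (h3 : (X.toMatrix⁻¹ * W.toMatrix * X.toMatrix⁻¹ * A.toMatrix * X.toMatrix⁻¹ *
      A.toMatrix).trace = 0) :
    HasDerivAt (fun t : ℝ => betaForm n β (X + t • W).toMatrix A A) 0 0 := by
  have hu : IsUnit X.toMatrix := hX.isUnit
  have hd : IsUnit X.toMatrix.det := (isUnit_iff_isUnit_det _).1 hu
  have hY := hasDerivAt_inv_line hu W.toMatrix
  have hYA := hY.mul_const A.toMatrix
  have ht2 := hasDerivAt_trace hYA
  have ht3 := hasDerivAt_trace ((hYA.mul hY).mul_const A.toMatrix)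
  have hdet := (hasDerivAt_det_line hd W.toMatrix).rpow_const (p := β)
    (Or.inl (by simpa using hX.det_pos.ne'))
  have h := hdet.mul (ht3.sub ((ht2.const_mul β).mul ht2))
  simp only [betaForm, LinearMap.mk₂_apply, map_add, map_smul]
  refine h.congr_deriv ?_
  have h3' : (X.toMatrix⁻¹ * A.toMatrix * (X.toMatrix⁻¹ * W.toMatrix * X.toMatrix⁻¹) *
      A.toMatrix).trace = 0 := by
    rw [← h3, Matrix.mul_assoc (X.toMatrix⁻¹ * A.toMatrix), trace_mul_comm]
    simp only [Matrix.mul_assoc]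
  simp [h1, h2, h3, h3', Matrix.add_mul]

end Derivative

/-- The metric as a map into the continuous bilinear forms. -/
noncomputable def betaBilin (n : ℕ) (β : ℝ) (X : SymMat n) : SymMat n →L[ℝ] SymMat n →L[ℝ] ℝ :=
  (betaForm n β X.toMatrix).toContinuousBilinearMap

theorem contDiffOn_betaBilin (n : ℕ) (β : ℝ) : ContDiffOn ℝ ∞ (betaBilin n β) (PosDefCone n) :=
  contDiffOn_clm_apply.2 fun A => contDiffOn_clm_apply.2 fun B => contDiffOn_betaForm n β A B

theorem fderiv_betaBilin_eq_zero {n : ℕ} (β : ℝ) {X : SymMat n} (hX : X ∈ PosDefCone n)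
    {W A : SymMat n} (h1 : (X.toMatrix⁻¹ * W.toMatrix).trace = 0)
    (h2 : (X.toMatrix⁻¹ * W.toMatrix * X.toMatrix⁻¹ * A.toMatrix).trace = 0)
    (h3 : (X.toMatrix⁻¹ * W.toMatrix * X.toMatrix⁻¹ * A.toMatrix * X.toMatrix⁻¹ *
      A.toMatrix).trace = 0) :
    fderiv ℝ (betaBilin n β) X W A A = 0 := by
  have hd : DifferentiableAt ℝ (betaBilin n β) X :=
    ((contDiffOn_betaBilin n β).contDiffAt ((PosDefCone n).isOpen.mem_nhds hX)).differentiableAt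
      (by simp)
  have hAA := hasFDerivAt_bilinear_apply hd.hasFDerivAt A A
  have h := fderiv_eq_of_hasDerivAt_line (a := W) hAA.differentiableAt
    (hasDerivAt_betaForm_line β hX h1 h2 h3)
  rw [hAA.fderiv] at h
  exact h

/-! ### Diagonal matrices -/

section Diagonal

open Matrix

/-- The diagonal matrix with prescribed diagonal entries, as a symmetric matrix. -/
noncomputable def diagonalSym (n : ℕ) : (Fin n → ℝ) →L[ℝ] SymMat n :=
  LinearMap.toContinuousLinearMap
    { toFun := fun d => (⟨diagonal d, isSymm_diagonal d⟩ : symSubmodule n)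
      map_add' := fun d e => SymMat.toMatrix_injective (diagonal_add d e).symm
      map_smul' := fun r d => SymMat.toMatrix_injective (diagonal_smul r d) }

/-- The diagonal entries of a symmetric matrix. -/
noncomputable def diagEntries (n : ℕ) : SymMat n →L[ℝ] (Fin n → ℝ) :=
  LinearMap.toContinuousLinearMap ((diagLinearMap (Fin n) ℝ ℝ) ∘ₗ SymMat.toMatrix)

theorem toMatrix_diagonalSym {n : ℕ} (d : Fin n → ℝ) :
    (diagonalSym n d).toMatrix = diagonal d := rfl

theorem diagEntries_apply {n : ℕ} (X : SymMat n) (i : Fin n) :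
    diagEntries n X i = X.toMatrix i i := rfl

theorem isLinearSlice_posDiagonal (n : ℕ) :
    IsLinearSlice (PosDefCone n) (posDiagonal n) (diagonalSym n) (diagEntries n) where
  leftInverse d := by
    ext i
    rw [diagEntries_apply, toMatrix_diagonalSym, diagonal_apply_eq]
  mem_iff X := by
    refine (isDiag_iff_diagonal_diag (PosDefCone.mat X)).trans ?_
    exact ⟨fun h => SymMat.toMatrix_injective h, fun h => congrArg SymMat.toMatrix h⟩

theorem nonempty_posDiagonal (n : ℕ) : Nonempty (posDiagonal n) :=
  ⟨⟨⟨diagonalSym n 1, by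
    change (diagonal 1 : Matrix (Fin n) (Fin n) ℝ).PosDef
    exact PosDef.diagonal fun _ => one_pos⟩, isDiag_diagonal _⟩⟩

/-- The complement is the space of symmetric matrices with zero diagonal, the retraction is the
diagonal part of the Cholesky decomposition. -/
theorem isTotallyGeodesic_posDiagonal (n : ℕ) (β : ℝ) (hβ : β < 1 / n) :
    IsTotallyGeodesicSubmanifold (betaMetric n β hβ) (posDiagonal n) ∧
      IsTotallyGeodesicForMinimizers (betaMetric n β hβ) (posDiagonal n) := by
  have := nonempty_posDiagonal n
  refine (isLinearSlice_posDiagonal n).isTotallyGeodesic (betaMetric n β hβ) (b := betaBilin n β)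
    (fun X A B => rfl) ((contDiffOn_betaBilin n β).differentiableOn (by simp)) ?_
    (ρ := choleskyDiag) ((contDiffOn_choleskyDiag n).of_le two_le_infty) ?_ ?_ ?_
  · intro W
    refine ⟨diagEntries n W, W - diagonalSym n (diagEntries n W), by abel, fun y a hy => ?_⟩
    set K := W - diagonalSym n (diagEntries n W) with hK
    have hK0 : ∀ i, K.toMatrix i i = 0 := fun i => by
      rw [hK, map_sub, toMatrix_diagonalSym, Matrix.sub_apply, diagonal_apply_eq, diagEntries_apply,
        sub_self]
    constructor
    · change betaForm n β _ _ _ = 0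
      simp [betaForm, LinearMap.mk₂_apply, toMatrix_diagonalSym, inv_diagonal, Matrix.trace, hK0]
    · apply fderiv_betaBilin_eq_zero β hy <;>
      simp [Matrix.trace, inv_diagonal, toMatrix_diagonalSym, hK0]
  · intro X hX
    obtain ⟨T, hT, hu, hXT⟩ := exists_cholesky hX
    change (diagonal (choleskyDiag X)).PosDef
    refine PosDef.diagonal fun i => ?_
    rw [choleskyDiag_eq hT hu hXT]
    exact sq_pos_of_ne_zero (diag_ne_zero_of_lower hT hu i)
  · rintro ⟨X, hX⟩
    have hXd : (X : SymMat n).toMatrix = diagonal (diag (X : SymMat n).toMatrix) :=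
      ((isDiag_iff_diagonal_diag _).1 hX).symm
    have hpos : ∀ i, 0 < (X : SymMat n).toMatrix i i := fun i =>
      (PosDefCone.mat_posDef X).diag_pos
    -- The Cholesky factor of a diagonal matrix is its entrywise square root.
    have hXT : (X : SymMat n).toMatrix = (diagonal fun i => √((X : SymMat n).toMatrix i i)) *
        (diagonal fun i => √((X : SymMat n).toMatrix i i))ᵀ := by
      rw [diagonal_transpose, diagonal_mul_diagonal]
      conv_lhs => rw [hXd]
      congr 1
      ext i
      exact (Real.mul_self_sqrt (hpos i).le).symm
    ext i
    rw [choleskyDiag_eq (blockTriangular_diagonal _) ?_ hXT, diagonal_apply_eq,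
      Real.sq_sqrt (hpos i).le, diagEntries_apply]
    rw [det_diagonal, isUnit_iff_ne_zero]
    exact Finset.prod_ne_zero_iff.2 fun i _ => (Real.sqrt_pos.2 (hpos i)).ne'
  · intro X hX A
    obtain ⟨T, hT, hu, hXT⟩ := exists_cholesky hX
    obtain ⟨S, hS⟩ := exists_congruence hu A.toMatrix
    have hne := diag_ne_zero_of_lower hT hu
    have hd : fderiv ℝ choleskyDiag X A = fun i => T i i ^ 2 * S i i :=
      fderiv_eq_of_hasDerivAt_line
        (((contDiffOn_choleskyDiag n).contDiffAt
          ((PosDefCone n).isOpen.mem_nhds hX)).differentiableAt (by simp))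
        (hasDerivAt_pi.2 fun i => hasDerivAt_choleskyDiag_line hT hu hXT hS i)
    have hD : choleskyDiag X = fun i => T i i ^ 2 := funext fun i => choleskyDiag_eq hT hu hXT i
    have hdet : (diagonal fun i => T i i ^ 2).det = X.toMatrix.det := by
      rw [hXT, det_mul, det_transpose, det_of_isLowerTriangular _ hT, det_diagonal,
        Finset.prod_pow]
      ring
    have hTd : IsUnit (diagonal fun i => T i i).det := by
      rw [det_diagonal, isUnit_iff_ne_zero]
      exact Finset.prod_ne_zero_iff.2 fun i _ => hne i
    rw [hd, hD]
    change betaForm n β (diagonal fun i => T i i ^ 2) _ _ ≤ betaForm n β X.toMatrix A A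
    -- Source and image are compared through the congruences by `T` and by its diagonal part.
    rw [betaForm_self_of_congruence β hu hXT hS,
      betaForm_self_of_congruence β (T := diagonal fun i => T i i) (S := diagonal fun i => S i i)
        hTd ?_ ?_, hdet]
    · refine mul_le_mul_of_nonneg_left ?_ (Real.rpow_nonneg (PosDef.det_pos hX).le β)
      have htr : (diagonal fun i => S i i).trace = S.trace := by
        rw [trace_diagonal]
        rfl
      rw [htr]
      refine sub_le_sub_right (Finset.sum_le_sum fun i _ => ?_) _
      rw [Finset.sum_eq_single i (fun j _ hj => by rw [diagonal_apply_ne' _ hj]; simp) (by simp),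
        diagonal_apply_eq]
      exact Finset.single_le_sum (f := fun j => S i j ^ 2) (fun j _ => sq_nonneg _)
        (Finset.mem_univ i)
    · rw [diagonal_transpose, diagonal_mul_diagonal]
      congr 1
      ext i
      ring
    · rw [toMatrix_diagonalSym, diagonal_transpose, diagonal_mul_diagonal, diagonal_mul_diagonal]
      congr 1
      ext i
      ring

end Diagonal

/-! ### Scalar matrices -/

section Scalar

open Matrix

/-- The scalar matrices, as symmetric matrices. -/
noncomputable def scalarSym (n : ℕ) : ℝ →L[ℝ] SymMat n :=
  ContinuousLinearMap.toSpanSingleton ℝ (⟨1, isSymm_one⟩ : symSubmodule n)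

/-- The mean of the diagonal entries of a symmetric matrix. -/
noncomputable def meanTrace (n : ℕ) : SymMat n →L[ℝ] ℝ :=
  LinearMap.toContinuousLinearMap ((n : ℝ)⁻¹ • ((traceLinearMap (Fin n) ℝ ℝ) ∘ₗ SymMat.toMatrix))

theorem toMatrix_scalarSym {n : ℕ} (r : ℝ) :
    (scalarSym n r).toMatrix = r • (1 : Matrix (Fin n) (Fin n) ℝ) := rfl

theorem meanTrace_apply {n : ℕ} (X : SymMat n) :
    meanTrace n X = (n : ℝ)⁻¹ * X.toMatrix.trace := rfl

theorem meanTrace_of_scalar {n : ℕ} (hn : 1 ≤ n) {X : SymMat n} {r : ℝ}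
    (hX : X.toMatrix = r • (1 : Matrix (Fin n) (Fin n) ℝ)) : meanTrace n X = r := by
  have hn0 : (n : ℝ) ≠ 0 := by exact_mod_cast (by omega : n ≠ 0)
  rw [meanTrace_apply, hX, trace_smul, trace_one, Fintype.card_fin, smul_eq_mul]
  field_simp

theorem isLinearSlice_posScalar (n : ℕ) (hn : 1 ≤ n) :
    IsLinearSlice (PosDefCone n) (posScalar n) (scalarSym n) (meanTrace n) where
  leftInverse r := meanTrace_of_scalar hn rfl
  mem_iff X := by
    have : Nonempty (Fin n) := ⟨⟨0, hn⟩⟩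
    constructor
    · rintro ⟨α, -, hα⟩
      rw [meanTrace_of_scalar hn hα]
      exact SymMat.toMatrix_injective hα.symm
    · intro h
      refine ⟨meanTrace n X, ?_, (congrArg SymMat.toMatrix h).symm⟩
      rw [meanTrace_apply]
      have := (PosDefCone.mat_posDef X).trace_pos
      have hn0 : (0 : ℝ) < n := by exact_mod_cast hn
      exact mul_pos (inv_pos.2 hn0) this

theorem posDef_scalar {n : ℕ} {r : ℝ} (hr : 0 < r) :
    (r • (1 : Matrix (Fin n) (Fin n) ℝ)).PosDef := PosDef.one.smul hr

theorem nonempty_posScalar (n : ℕ) : Nonempty (posScalar n) :=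
  ⟨⟨⟨scalarSym n 1, posDef_scalar one_pos⟩, 1, one_pos, rfl⟩⟩

/-- The complement is the space of trace-free symmetric matrices, the retraction is
`X ↦ (det X)^(1/n) I`. -/
theorem isTotallyGeodesic_posScalar (n : ℕ) (hn : 1 ≤ n) (β : ℝ) (hβ : β < 1 / n) :
    IsTotallyGeodesicSubmanifold (betaMetric n β hβ) (posScalar n) ∧
      IsTotallyGeodesicForMinimizers (betaMetric n β hβ) (posScalar n) := by
  have := nonempty_posScalar n
  have hn0 : (n : ℝ) ≠ 0 := by exact_mod_cast (by omega : n ≠ 0)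
  have hn1 : n ≠ 0 := by omega
  have hρ : ContDiffOn ℝ ∞ (fun X : SymMat n => X.toMatrix.det ^ (n : ℝ)⁻¹) (PosDefCone n) :=
    (contDiffOn_det fun i j => (SymMat.contDiff_entry i j).contDiffOn).rpow_const_of_ne
      fun X hX => (PosDef.det_pos hX).ne'
  refine (isLinearSlice_posScalar n hn).isTotallyGeodesic (betaMetric n β hβ) (b := betaBilin n β)
    (fun X A B => rfl) ((contDiffOn_betaBilin n β).differentiableOn (by simp)) ?_
    (ρ := fun X => X.toMatrix.det ^ (n : ℝ)⁻¹) (hρ.of_le two_le_infty) ?_ ?_ ?_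
  · intro W
    refine ⟨meanTrace n W, W - scalarSym n (meanTrace n W), by abel, fun y a hy => ?_⟩
    set K := W - scalarSym n (meanTrace n W) with hK
    have hK0 : K.toMatrix.trace = 0 := by
      rw [hK, map_sub, toMatrix_scalarSym, meanTrace_apply, trace_sub, trace_smul, trace_one,
        Fintype.card_fin, smul_eq_mul]
      field_simp
      ring
    have hinv : (y • (1 : Matrix (Fin n) (Fin n) ℝ))⁻¹ = y⁻¹ • 1 := by
      rcases eq_or_ne y 0 with rfl | hy0
      · simp
      · exact inv_eq_left_inv (by simp [smul_smul, hy0])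
    constructor
    · change betaForm n β _ _ _ = 0
      simp [betaForm, LinearMap.mk₂_apply, toMatrix_scalarSym, hinv, hK0]
    · apply fderiv_betaBilin_eq_zero β hy <;>
      simp [hinv, toMatrix_scalarSym, hK0]
  · intro X hX
    exact posDef_scalar (Real.rpow_pos_of_pos (PosDef.det_pos hX) _)
  · rintro ⟨X, r, hr, hX⟩
    have hX' : (X : SymMat n).toMatrix = r • (1 : Matrix (Fin n) (Fin n) ℝ) := hX
    simp only [meanTrace_of_scalar hn hX', hX', det_smul, det_one, Fintype.card_fin, mul_one]
    exact Real.pow_rpow_inv_natCast hr.le hn1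
  · intro X hX A
    obtain ⟨T, -, hu, hXT⟩ := exists_cholesky hX
    obtain ⟨S, hS⟩ := exists_congruence hu A.toMatrix
    have hdpos : 0 < X.toMatrix.det := PosDef.det_pos hX
    set r := X.toMatrix.det ^ (n : ℝ)⁻¹ with hr
    have hrpos : 0 < r := Real.rpow_pos_of_pos hdpos _
    have hline : ∀ t : ℝ, (X + t • A).toMatrix.det = X.toMatrix.det * (1 + t • S).det := by
      intro t
      have h1 : T * Tᵀ + t • (T * S * Tᵀ) = T * (1 + t • S) * Tᵀ := by
        simp [Matrix.mul_add, Matrix.add_mul]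
      rw [map_add, map_smul, hS, hXT, h1, det_mul, det_mul, det_mul]
      ring
    have hd : fderiv ℝ (fun X : SymMat n => X.toMatrix.det ^ (n : ℝ)⁻¹) X A =
        r * ((n : ℝ)⁻¹ * S.trace) := by
      refine fderiv_eq_of_hasDerivAt_line ((hρ.contDiffAt
        ((PosDefCone n).isOpen.mem_nhds hX)).differentiableAt (by simp)) ?_
      simp only [hline]
      refine (((hasDerivAt_det_one_add_smul S).const_mul X.toMatrix.det).rpow_const
        (p := (n : ℝ)⁻¹) (Or.inl (by simpa using hdpos.ne'))).congr_deriv ?_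
      simp only [zero_smul, add_zero, det_one, mul_one]
      rw [Real.rpow_sub_one hdpos.ne', ← hr]
      field_simp
    have hdet : (r • (1 : Matrix (Fin n) (Fin n) ℝ)).det = X.toMatrix.det := by
      rw [det_smul, det_one, Fintype.card_fin, mul_one, hr, Real.rpow_inv_natCast_pow hdpos.le hn1]
    have hTd : IsUnit (√r • (1 : Matrix (Fin n) (Fin n) ℝ)).det := by
      rw [det_smul, det_one, mul_one, isUnit_iff_ne_zero]
      exact pow_ne_zero _ (Real.sqrt_pos.2 hrpos).ne'
    rw [hd]
    change betaForm n β (r • (1 : Matrix (Fin n) (Fin n) ℝ)) _ _ ≤ betaForm n β X.toMatrix A A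
    -- The image is compared with the source through the congruence by `√r I`.
    rw [betaForm_self_of_congruence β hu hXT hS,
      betaForm_self_of_congruence β (T := √r • 1) (S := ((n : ℝ)⁻¹ * S.trace) • 1)
        hTd ?_ ?_, hdet]
    · refine mul_le_mul_of_nonneg_left ?_ (Real.rpow_nonneg hdpos.le β)
      have htr : (((n : ℝ)⁻¹ * S.trace) • (1 : Matrix (Fin n) (Fin n) ℝ)).trace = S.trace := by
        rw [trace_smul, trace_one, Fintype.card_fin, smul_eq_mul]
        field_simp
      rw [htr]
      refine sub_le_sub_right ?_ _
      have hsum : ∑ i, ∑ j, (((n : ℝ)⁻¹ * S.trace) • (1 : Matrix (Fin n) (Fin n) ℝ)) i j ^ 2 =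
          S.trace ^ 2 / n := by
        simp [Matrix.one_apply]
        field_simp
      rw [hsum, div_le_iff₀' (by positivity)]
      exact trace_sq_le n S
    · simp [smul_smul, Real.mul_self_sqrt hrpos.le]
    · rw [toMatrix_scalarSym]
      simp only [transpose_smul, transpose_one, Matrix.mul_smul, Matrix.mul_one,
        smul_smul]
      rw [← Real.mul_self_sqrt hrpos.le]
      congr 1
      rw [Real.sqrt_mul_self (Real.sqrt_nonneg r)]
      ring

end Scalar

theorem mainTheorem7 (n : ℕ) (hn : 1 ≤ n) (β : ℝ) (hβ₀ : β ≠ 0) (hβ : β < 1 / n) :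
    (IsTotallyGeodesicSubmanifold (betaMetric n β hβ) (posDiagonal n) ∧
      IsTotallyGeodesicSubmanifold (betaMetric n β hβ) (posScalar n)) ∧
    (IsTotallyGeodesicForMinimizers (betaMetric n β hβ) (posDiagonal n) ∧
      IsTotallyGeodesicForMinimizers (betaMetric n β hβ) (posScalar n)) := by
  have hdiag := isTotallyGeodesic_posDiagonal n β hβ
  have hscal := isTotallyGeodesic_posScalar n hn β hβ
  exact ⟨⟨hdiag.1, hscal.1⟩, hdiag.2, hscal.2⟩
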